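/- **Setting.** Let $k\ge 1$. Let $E\subset\mathbb R^2$ be the bounded open domain enclosed by a simple closed polygonal curve with $N=N(E)\ge 3$ vertices $p_1,\dots,p_N$ and $N$ edges (straight segments between cyclically consecutive vertices; consecutive edges may be collinear). Write $h_E$ for the diameter of $E$, $h_{m(E)}$ for the length of its shortest edge, $|\partial E|$ for the length of its boundary. Let $$V_E=\{v\in H^1(E)\cap C^0(\overline E):\ -\Delta v\in\mathbb P_{k-2}(E),\ v|_e\in\mathbb P_k(e)\ \text{for every edge } e\},\qquad \mathbb P_{-1}=\{0\},$$ $$a_E(v,w)=\int_E\nabla v\cdot\nabla w,\qquad |v|_{1,E}^2=a_E(v,v),\qquad |v|_{1/2,\partial E}^2=\int_{\partial E}\int_{\partial E}\Big(\frac{v(s_1)-v(s_2)}{s_1-s_2}\Big)^2ds_1\,ds_2,$$ where $s_1,s_2$ are curvilinear abscissae and $|s_1-s_2|$ is understood as the arc length distance along the closed curve $\partial E$. Let $\mathcal R$ be any one of $$\mathcal Rv=\frac1{|E|}\int_E v,\qquad \mathcal Rv=\frac1{|\partial E|}\int_{\partial E}v,\qquad \mathcal Rv=\frac1N\sum_{i=1}^N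 v(p_i),$$ and, for $v\in V_E$, let $\Pi_Ev\in\mathbb P_k(E)$ be determined by $a_E(v-\Pi_Ev,p)=0$ for all $p\in\mathbb P_k(E)$ and $\mathcal R(v-\Pi_Ev)=0$. Let $\Xi^\partial_1,\dots,\Xi^\partial_{Nk}$ be the boundary degrees of freedom, namely the values at the $N$ vertices and at $k-1$ distinct points in the interior of each edge, and let $$s_E^\partial(v,w)=\sum_{i=1}^{Nk}\Xi_i^\partial(v)\,\Xi_i^\partial(w).$$ **Theorem.** Let $k\ge1$, $\gamma>0$, $M\in\mathbb N$ and $\delta>0$. There is a constant $c>0$, depending only on $k,\gamma,M,\delta$, such that the following holds for every such polygon $E$ that satisfies * (A1) $E$ is star-shaped with respect to a ball of radius $\rho_E\ge\gamma h_E$, * (A2) $N(E)\le M$, for every choice of nodes such that, on each edge $e$, the $k-1$ interior nodes and the two endpoints are at mutual distance at least $\delta h_e$ (for instance the affine images of one fixed set of reference nodes such as the Gauss–Lobatto nodes, with $\delta$ depending only on the reference nodes), and for each of the three choices of $\mathcal R$. For every $v\in V_E$ the polynomial $\Pi_Ev$ exists and is unique, and there are constants $\widehat C_1(E),\widehat C_2(E)>0$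 with $$|v_h|_{1/2,\partial E}^2\le\widehat C_1(E)\Big(s_E^\partial\big((I-\mathcal R)v_h,(I-\mathcal R)v_h\big)+|\Pi_Ev_h|_{1,E}^2\Big)\qquad\forall v_h\in V_E,$$ $$s_E^\partial\big((I-\mathcal R)p,(I-\mathcal R)p\big)\le\widehat C_2(E)\,|p|_{1,E}^2\qquad\forall p\in\mathbb P_k(E),$$ $$\widehat C_1(E)\le c\,\log\!\big(1+h_E/h_{m(E)}\big),\qquad \widehat C_2(E)\le c .$$ -/

import Mathlib

open MeasureTheory
open scoped ContDiff ENNReal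

noncomputable section

namespace VEM

/-- The Euclidean plane. -/
abbrev Plane : Type := EuclideanSpace ℝ (Fin 2)

/-! ### Sobolev space of order one through weak gradients -/

/-- `g` is a square integrable weak gradient of `v` on the open set `U`:
`∫_U v ∇φ = - ∫_U φ g` for all test functions `φ ∈ C_c^∞(U)`. -/
def IsWeakGradient (U : Set Plane) (v : Plane → ℝ) (g : Plane → Plane) : Prop :=
  MemLp g 2 (volume.restrict U) ∧
    ∀ φ : Plane → ℝ, ContDiff ℝ ∞ φ → HasCompactSupport φ → tsupport φ ⊆ U →
      ∫ x in U, v x • gradient φ x = - ∫ x in U, φ x • g x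

/-- `v ∈ H¹(U)`. -/
def MemH1 (U : Set Plane) (v : Plane → ℝ) : Prop :=
  MemLp v 2 (volume.restrict U) ∧ ∃ g, IsWeakGradient U v g

open Classical in
/-- The weak gradient of `v` on `U` (unique up to null sets when it exists). -/
def weakGrad (U : Set Plane) (v : Plane → ℝ) : Plane → Plane :=
  if h : ∃ g, IsWeakGradient U v g then h.choose else 0

/-- The form `a_U(v, w) = ∫_U ∇v · ∇w`. In particular `|v|²_{1,U} = a_U(v, v)`. -/
def energyForm (U : Set Plane) (v w : Plane → ℝ) : ℝ :=
  ∫ x in U, inner ℝ (weakGrad U v x) (weakGrad U w x)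

/-- The polynomial function on the plane given by `q`. -/
def polyFun (q : MvPolynomial (Fin 2) ℝ) : Plane → ℝ :=
  fun x => MvPolynomial.eval (fun i => x i) q

/-- `f ∈ ℙ_k`: `f` is a polynomial function of total degree at most `k`. -/
def IsPoly (k : ℕ) (f : Plane → ℝ) : Prop :=
  ∃ q : MvPolynomial (Fin 2) ℝ, q.totalDegree ≤ k ∧ f = polyFun q

/-- `f ∈ ℙ_{k-2}`, with the convention `ℙ_{-1} = {0}`. -/
def IsPolySubTwo (k : ℕ) (f : Plane → ℝ) : Prop :=
  f = 0 ∨ ∃ q : MvPolynomial (Fin 2) ℝ, q.totalDegree + 2 ≤ k ∧ f = polyFun q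

/-! ### Polygonal elements -/

/-- A simple polygon with `N` vertices and `N` edges (consecutive edges may be collinear).
The edges form a simple closed curve, and `carrier` is the bounded domain enclosed by it. -/
structure PolygonalElement (N : ℕ) where
  poly : Polygon Plane N
  three_le : 3 ≤ N
  /-- the closed polygonal curve, with each edge parametrized over `[0, 1)`, is injective -/
  simple : ∀ i j : Fin N, ∀ s ∈ Set.Ico (0 : ℝ) 1, ∀ t ∈ Set.Ico (0 : ℝ) 1,
    poly.edgePath ℝ i s = poly.edgePath ℝ j t → i = j ∧ s = t
  carrier : Set Plane
  isOpen : IsOpen carrier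
  isConnected : IsConnected carrier
  isBounded : Bornology.IsBounded carrier
  frontier_eq : frontier carrier = poly.boundary ℝ

namespace PolygonalElement

variable {N : ℕ} (E : PolygonalElement N)

/-- The diameter `h_E`. -/
def diameter : ℝ := Metric.diam E.carrier

/-- The length `h_e` of the `i`-th edge. -/
def edgeLength (i : Fin N) : ℝ := dist (E.poly i) (E.poly (finRotate N i))

/-- The length `h_{m(E)}` of the shortest edge. -/
def minEdgeLength : ℝ := ⨅ i, E.edgeLength i

/-- The length `|∂E|` of the boundary. -/
def perimeter : ℝ := ∑ i, E.edgeLength i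

/-- The point of the `i`-th edge at arc length `s` from the initial vertex of that edge. -/
def edgePoint (i : Fin N) (s : ℝ) : Plane := E.poly.edgePath ℝ i (s / E.edgeLength i)

/-- The curvilinear abscissa (arc length from vertex `0`) of `edgePoint i s`. -/
def abscissa (i : Fin N) (s : ℝ) : ℝ := ∑ j ∈ Finset.Iio i, E.edgeLength j + s

/-- The arc length distance, along the closed curve `∂E`, of two points that are given by
their curvilinear abscissae `a, b ∈ [0, |∂E|]`. -/
def arcDist (a b : ℝ) : ℝ := min |a - b| (E.perimeter - |a - b|)

/-- The squared seminorm
`|v|²_{1/2,∂E} = ∫_{∂E} ∫_{∂E} ((v(s₁) - v(s₂)) / (s₁ - s₂))² ds₁ ds₂`. -/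
def halfSeminormSq (v : Plane → ℝ) : ℝ≥0∞ :=
  ∑ i, ∑ j, ∫⁻ s in Set.Icc 0 (E.edgeLength i), ∫⁻ t in Set.Icc 0 (E.edgeLength j),
    ENNReal.ofReal (((v (E.edgePoint i s) - v (E.edgePoint j t)) /
      E.arcDist (E.abscissa i s) (E.abscissa j t)) ^ 2)

/-- `E` is star-shaped with respect to every point of a ball of radius at least `γ h_E`. -/
def IsStarShaped (γ : ℝ) : Prop :=
  ∃ (x : Plane) (ρ : ℝ), γ * E.diameter ≤ ρ ∧ Metric.ball x ρ ⊆ E.carrier ∧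
    ∀ y ∈ Metric.ball x ρ, StarConvex ℝ y E.carrier

/-- The local virtual element space `V_E` of order `k`. Functions are defined on the whole plane,
but only their values on the closure of `E` matter. -/
structure MemVirtualSpace (k : ℕ) (v : Plane → ℝ) : Prop where
  memH1 : MemH1 E.carrier v
  continuousOn : ContinuousOn v (closure E.carrier)
  /-- `-Δv ∈ ℙ_{k-2}(E)` in the weak sense -/
  laplacian : ∃ f, IsPolySubTwo k f ∧
    ∀ φ : Plane → ℝ, ContDiff ℝ ∞ φ → HasCompactSupport φ → tsupport φ ⊆ E.carrier →
      ∫ x in E.carrier, inner ℝ (weakGrad E.carrier v x) (gradient φ x) =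
        ∫ x in E.carrier, f x * φ x
  /-- `v|_e ∈ ℙ_k(e)` for every edge `e` -/
  edge_poly : ∀ i : Fin N, ∃ q : Polynomial ℝ, q.natDegree ≤ k ∧
    ∀ t ∈ Set.Icc (0 : ℝ) 1, v (E.poly.edgePath ℝ i t) = q.eval t

end PolygonalElement

/-- The three projections onto the constants. -/
inductive MeanChoice
  /-- the average over the element -/
  | element
  /-- the average over the boundary -/
  | boundary
  /-- the average of the vertex values -/
  | vertices

/-- The value of the constant `R v`, for each of the three choices of `R`. -/
def MeanChoice.apply (R : MeanChoice) {N : ℕ} (E : PolygonalElement N) (v : Plane → ℝ) : ℝ :=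
  match R with
  | .element => (volume.real E.carrier)⁻¹ * ∫ x in E.carrier, v x
  | .boundary => E.perimeter⁻¹ * ∑ i, ∫ s in (0 : ℝ)..E.edgeLength i, v (E.edgePoint i s)
  | .vertices => (N : ℝ)⁻¹ * ∑ i, v (E.poly i)

namespace PolygonalElement

variable {N : ℕ} (E : PolygonalElement N)

/-- `(I - R) v`. -/
def subMean (R : MeanChoice) (v : Plane → ℝ) : Plane → ℝ := fun x => v x - R.apply E v

/-- `q = Π_E v`: the element of `ℙ_k` with `a_E(v - q, p) = 0` for all `p ∈ ℙ_k` and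
`R (v - q) = 0`. -/
structure IsProjection (R : MeanChoice) (k : ℕ) (v q : Plane → ℝ) : Prop where
  isPoly : IsPoly k q
  orthogonal : ∀ p, IsPoly k p → energyForm E.carrier (v - q) p = 0
  mean_eq : R.apply E (v - q) = 0

/-- The identity matrix boundary form `∑_{i=1}^{Nk} Ξ_i(v) Ξ_i(w)`, the sum over the `N` vertex
values and the values at the `k - 1` interior nodes of each edge. The `m`-th node of the `i`-th
edge is at the relative position `τ i m ∈ (0, 1)`. -/
def boundaryForm {k : ℕ} (τ : Fin N → Fin (k - 1) → ℝ) (v w : Plane → ℝ) : ℝ :=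
  ∑ i, v (E.poly i) * w (E.poly i) +
    ∑ i, ∑ m, v (E.poly.edgePath ℝ i (τ i m)) * w (E.poly.edgePath ℝ i (τ i m))

/-- `|v|²_{1/2,∂E} ≤ C (s(v - R v, v - R v) + |Π_E v|²_{1,E})` for all `v ∈ V_E`. -/
def BoundaryCoercive (R : MeanChoice) (k : ℕ) (τ : Fin N → Fin (k - 1) → ℝ) (C : ℝ) : Prop :=
  ∀ v, E.MemVirtualSpace k v → ∀ q, E.IsProjection R k v q →
    E.halfSeminormSq v ≤ ENNReal.ofReal
      (C * (E.boundaryForm τ (E.subMean R v) (E.subMean R v) + energyForm E.carrier q q))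

/-- `s(p - R p, p - R p) ≤ C |p|²_{1,E}` for all `p ∈ ℙ_k`. -/
def BoundaryBounded (R : MeanChoice) (k : ℕ) (τ : Fin N → Fin (k - 1) → ℝ) (C : ℝ) : Prop :=
  ∀ p, IsPoly k p →
    E.boundaryForm τ (E.subMean R p) (E.subMean R p) ≤ C * energyForm E.carrier p p

end PolygonalElement

/-- On every edge, the interior nodes and the two endpoints are at mutual relative distance at
least `δ`. For nodes that are affine images of one fixed set of distinct reference nodes in
`(0, 1)` (such as the Gauss-Lobatto nodes) this holds with some `δ > 0` that depends only on the
reference nodes. -/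
def SeparatedNodes {N k : ℕ} (δ : ℝ) (τ : Fin N → Fin (k - 1) → ℝ) : Prop :=
  (∀ i m, τ i m ∈ Set.Icc δ (1 - δ)) ∧ ∀ i m n, m ≠ n → δ ≤ |τ i m - τ i n|

end VEM

end

/-! The argument has three independent parts.

Projection: on the finite-dimensional space `polySpace k`, the form a_E(p, q) + R(p) R(q) is
injective. A polynomial of zero energy on a connected open set is constant, and each R fixes
constants (`augmentedForm_injective`). The two conditions that define the projection say exactly
that it represents one linear functional in this form (`isProjection_iff`), so it exists and is
unique.

Upper bound for polynomials: map the ball of radius ρ to the unit ball. The element then lies in the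
ball of radius 1/γ about the centre, where finite dimensionality bounds the oscillation of p by its
Dirichlet energy on the unit ball (`exists_sq_sub_le_dirichletForm`). In the plane this energy is
invariant under scaling (`dirichletForm_comp_affine`), so the constant does not depend on the size
of the element.

Lower bound: put w = v - R v and let S be the boundary form of w. On each edge w is a polynomial of
degree at most k with all nodal values at most √S. Lagrange interpolation at separated nodes bounds
w by K = C√S, and its slope in arc length by K/h_e (`exists_abs_eval_le`). A pair of points on one
edge then contributes at most K² in total. For points on different edges at arc distance d, with m
the shortest edge, |w(s) - w(t)| is at most both 2K and Kd/m, so the quotient is at most 3K/(r + m)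
for every nonnegative r ≤ d (`div_sq_le_kernel`). Integrating (r + m)⁻² twice gives log(1 + h_E/m),
which is the source of the logarithm (`PolygonalElement.halfSeminormSq_le`). -/

namespace VEM

/-! ### Polynomial functions on the plane -/

/-- `polyFun` as a linear map. -/
noncomputable def polyFunLinear : MvPolynomial (Fin 2) ℝ →ₗ[ℝ] (Plane → ℝ) where
  toFun := polyFun
  map_add' p q := by ext x; simp [polyFun]
  map_smul' c p := by ext x; simp [polyFun]

/-- The space `ℙ_k` of polynomial functions on the plane. -/
noncomputable def polySpace (k : ℕ) : Submodule ℝ (Plane → ℝ) :=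
  (MvPolynomial.restrictTotalDegree (Fin 2) ℝ k).map polyFunLinear

theorem mem_polySpace {k : ℕ} {f : Plane → ℝ} : f ∈ polySpace k ↔ IsPoly k f := by
  simp only [polySpace, Submodule.mem_map, MvPolynomial.mem_restrictTotalDegree, IsPoly]
  exact ⟨fun ⟨q, h, e⟩ => ⟨q, h, e.symm⟩, fun ⟨q, h, e⟩ => ⟨q, h, e.symm⟩⟩

instance (k : ℕ) : FiniteDimensional ℝ (polySpace k) := by
  unfold polySpace; infer_instance

theorem const_mem_polySpace (k : ℕ) (c : ℝ) : (fun _ => c) ∈ polySpace k := by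
  rw [mem_polySpace]
  exact ⟨MvPolynomial.C c, by simp, by ext; simp [polyFun]⟩

theorem analyticOnNhd_of_mem_polySpace {k : ℕ} {f : Plane → ℝ} (hf : f ∈ polySpace k) :
    AnalyticOnNhd ℝ f Set.univ := by
  obtain ⟨q, -, rfl⟩ := mem_polySpace.1 hf
  have h : AnalyticOnNhd ℝ (fun x : Plane => MvPolynomial.aeval (fun i => x i) q) Set.univ :=
    AnalyticOnNhd.aeval_mvPolynomial (fun i x _ =>
      (EuclideanSpace.proj i : Plane →L[ℝ] ℝ).analyticAt x) q
  simpa only [MvPolynomial.coe_aeval_eq_eval] using! h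

theorem contDiff_of_mem_polySpace {k : ℕ} {f : Plane → ℝ} (hf : f ∈ polySpace k) :
    ContDiff ℝ ∞ f :=
  (analyticOnNhd_of_mem_polySpace hf).contDiff

/-- A monomial with exponents d turns into a product of powers of the substituted polynomials, of
degree at most the sum of d. This keeps ℙ_k stable under the change of variables to the reference
ball. -/
theorem totalDegree_bind₁_le {p : MvPolynomial (Fin 2) ℝ} {g : Fin 2 → MvPolynomial (Fin 2) ℝ}
    (hg : ∀ i, (g i).totalDegree ≤ 1) : (MvPolynomial.bind₁ g p).totalDegree ≤ p.totalDegree := by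
  rw [MvPolynomial.bind₁, MvPolynomial.aeval_def, MvPolynomial.eval₂_eq]
  refine MvPolynomial.totalDegree_finsetSum_le fun d hd => ?_
  refine (MvPolynomial.totalDegree_mul _ _).trans ?_
  rw [MvPolynomial.algebraMap_eq, MvPolynomial.totalDegree_C, zero_add]
  refine (MvPolynomial.totalDegree_finsetProd _ _).trans ?_
  refine le_trans (Finset.sum_le_sum fun i _ => ?_) (MvPolynomial.le_totalDegree hd)
  refine (MvPolynomial.totalDegree_pow _ _).trans ?_
  simpa using Nat.mul_le_mul_left (d i) (hg i)

theorem comp_affine_mem_polySpace {k : ℕ} {f : Plane → ℝ} (hf : f ∈ polySpace k) (a : Plane)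
    (r : ℝ) : (fun y => f (a + r • y)) ∈ polySpace k := by
  obtain ⟨q, hq, rfl⟩ := mem_polySpace.1 hf
  refine mem_polySpace.2 ⟨MvPolynomial.bind₁
    (fun i => MvPolynomial.C (a i) + MvPolynomial.C r * MvPolynomial.X i) q,
    (totalDegree_bind₁_le fun i => ?_).trans hq, ?_⟩
  · refine (MvPolynomial.totalDegree_add _ _).trans (max_le (by simp) ?_)
    exact (MvPolynomial.totalDegree_mul _ _).trans (by simp)
  · ext y
    simp only [polyFun, MvPolynomial.eval, MvPolynomial.eval₂Hom_bind₁]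
    congr 2
    ext i
    simp

/-! ### Gradients -/

theorem gradient_eq_zero_of_notMem_tsupport {φ : Plane → ℝ} {x : Plane} (hx : x ∉ tsupport φ) :
    gradient φ x = 0 := by
  rw [gradient, fderiv_of_notMem_tsupport ℝ hx, map_zero]

theorem gradient_add' {f g : Plane → ℝ} (hf : Differentiable ℝ f) (hg : Differentiable ℝ g)
    (x : Plane) : gradient (f + g) x = gradient f x + gradient g x := by
  rw [gradient, fderiv_add (hf x) (hg x), map_add]; rfl

theorem gradient_sub' {f g : Plane → ℝ} (hf : Differentiable ℝ f) (hg : Differentiable ℝ g)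
    (x : Plane) : gradient (f - g) x = gradient f x - gradient g x := by
  rw [gradient, fderiv_sub (hf x) (hg x), map_sub]; rfl

theorem gradient_smul' {f : Plane → ℝ} (hf : Differentiable ℝ f) (c : ℝ)
    (x : Plane) : gradient (c • f) x = c • gradient f x := by
  rw [gradient, fderiv_const_smul (hf x) c, map_smulₛₗ]; rfl

theorem _root_.ContDiff.continuous_gradient {f : Plane → ℝ} (hf : ContDiff ℝ ∞ f) :
    Continuous (gradient f) :=
  (InnerProductSpace.toDual ℝ Plane).symm.continuous.comp (hf.continuous_fderiv (by simp))

theorem integrableOn_of_continuous {F : Type*} [NormedAddCommGroup F] {f : Plane → F}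
    (hf : Continuous f) {U : Set Plane} (hU : Bornology.IsBounded U) : IntegrableOn f U :=
  (hf.continuousOn.integrableOn_compact hU.isCompact_closure).mono_set subset_closure

theorem memLp_of_continuous {F : Type*} [NormedAddCommGroup F] {f : Plane → F}
    (hf : Continuous f) {U : Set Plane} (hU : Bornology.IsBounded U) :
    MemLp f 2 (volume.restrict U) := by
  rw [memLp_two_iff_integrable_sq_norm hf.aestronglyMeasurable]
  exact integrableOn_of_continuous (by fun_prop) hU

/-! ### The Dirichlet form of smooth functions -/

/-- `∫_U ∇f · ∇g` with classical gradients. -/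
noncomputable def dirichletForm (U : Set Plane) (f g : Plane → ℝ) : ℝ :=
  ∫ x in U, inner ℝ (gradient f x) (gradient g x)

theorem integrableOn_inner_gradient {U : Set Plane} (hU : Bornology.IsBounded U)
    {f g : Plane → ℝ} (hf : ContDiff ℝ ∞ f) (hg : ContDiff ℝ ∞ g) :
    IntegrableOn (fun x => inner ℝ (gradient f x) (gradient g x)) U :=
  integrableOn_of_continuous (hf.continuous_gradient.inner hg.continuous_gradient) hU

theorem dirichletForm_comm (U : Set Plane) (f g : Plane → ℝ) :
    dirichletForm U f g = dirichletForm U g f := by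
  simp only [dirichletForm, real_inner_comm]

theorem dirichletForm_self_nonneg (U : Set Plane) (f : Plane → ℝ) : 0 ≤ dirichletForm U f f :=
  integral_nonneg fun _ => real_inner_self_nonneg

theorem dirichletForm_add_left {U : Set Plane} (hU : Bornology.IsBounded U)
    {f g p : Plane → ℝ} (hf : ContDiff ℝ ∞ f) (hg : ContDiff ℝ ∞ g) (hp : ContDiff ℝ ∞ p) :
    dirichletForm U (f + g) p = dirichletForm U f p + dirichletForm U g p := by
  rw [dirichletForm, dirichletForm, dirichletForm, ← integral_add
    (integrableOn_inner_gradient hU hf hp) (integrableOn_inner_gradient hU hg hp)]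
  refine integral_congr_ae (.of_forall fun x => ?_)
  simp only [gradient_add' (hf.differentiable (by simp)) (hg.differentiable (by simp)),
    inner_add_left]

theorem dirichletForm_smul_left {U : Set Plane} {f : Plane → ℝ} (hf : ContDiff ℝ ∞ f)
    (p : Plane → ℝ) (c : ℝ) : dirichletForm U (c • f) p = c * dirichletForm U f p := by
  rw [dirichletForm, dirichletForm, ← integral_const_mul]
  refine integral_congr_ae (.of_forall fun x => ?_)
  simp only [gradient_smul' (hf.differentiable (by simp)), real_inner_smul_left]

theorem dirichletForm_mono {U V : Set Plane} (hUV : U ⊆ V) (hV : Bornology.IsBounded V)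
    {f : Plane → ℝ} (hf : ContDiff ℝ ∞ f) : dirichletForm U f f ≤ dirichletForm V f f :=
  setIntegral_mono_set (integrableOn_inner_gradient hV hf hf)
    (.of_forall fun _ => real_inner_self_nonneg) (.of_forall hUV)

/-- The Dirichlet form on `ℙ_k`, augmented by the square of a linear functional. -/
noncomputable def augmentedForm (k : ℕ) {U : Set Plane} (hU : Bornology.IsBounded U)
    (l : polySpace k →ₗ[ℝ] ℝ) : LinearMap.BilinForm ℝ (polySpace k) :=
  have hc : ∀ f : polySpace k, ContDiff ℝ ∞ (f : Plane → ℝ) :=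
    fun f => contDiff_of_mem_polySpace f.2
  LinearMap.mk₂ ℝ (fun f g => dirichletForm U f g + l f * l g)
    (fun f g p => by
      simp only [Submodule.coe_add, dirichletForm_add_left hU (hc f) (hc g) (hc p), map_add]
      ring)
    (fun c f p => by
      simp only [Submodule.coe_smul, dirichletForm_smul_left (hc f), map_smul, smul_eq_mul]
      ring)
    (fun p f g => by
      simp only [Submodule.coe_add, dirichletForm_comm U p,
        dirichletForm_add_left hU (hc f) (hc g) (hc p), map_add]
      ring)
    (fun c p f => by
      simp only [Submodule.coe_smul, dirichletForm_comm U p, dirichletForm_smul_left (hc f),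
        map_smul, smul_eq_mul]
      ring)

theorem augmentedForm_apply {k : ℕ} {U : Set Plane} (hU : Bornology.IsBounded U)
    (l : polySpace k →ₗ[ℝ] ℝ) (f g : polySpace k) :
    augmentedForm k hU l f g = dirichletForm U f g + l f * l g := rfl

/-- A polynomial with zero Dirichlet energy on a domain is constant. -/
theorem eq_const_of_dirichletForm_eq_zero {k : ℕ} {U : Set Plane} (ho : IsOpen U)
    (hc : IsConnected U) (hU : Bornology.IsBounded U) {f : Plane → ℝ} (hf : f ∈ polySpace k)
    (h : dirichletForm U f f = 0) : ∃ c : ℝ, f = fun _ => c := by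
  have hf' := contDiff_of_mem_polySpace hf
  have hcont : Continuous fun x => inner ℝ (gradient f x) (gradient f x) :=
    hf'.continuous_gradient.inner hf'.continuous_gradient
  have h0 : Set.EqOn (fun x => inner ℝ (gradient f x) (gradient f x)) 0 U := by
    refine Measure.eqOn_open_of_ae_eq (μ := volume) ?_ ho hcont.continuousOn continuousOn_const
    exact (setIntegral_eq_zero_iff_of_nonneg_ae (.of_forall fun _ => real_inner_self_nonneg)
      (integrableOn_inner_gradient hU hf' hf')).1 h
  obtain ⟨c, hcst⟩ := ho.exists_is_const_of_fderiv_eq_zero (𝕜 := ℝ) hc.isPreconnected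
    (hf'.differentiable (by simp)).differentiableOn (fun x hx => by
      have : gradient f x = 0 := by simpa using h0 hx
      rw [← toDual_gradient, this, map_zero]; rfl)
  obtain ⟨z, hz⟩ := hc.nonempty
  -- Elements of `polySpace` are functions on the whole plane, so constancy on U is propagated by
  -- the identity theorem.
  refine ⟨c, (analyticOnNhd_of_mem_polySpace hf).eq_of_eventuallyEq (z₀ := z)
    analyticOnNhd_const ?_⟩
  filter_upwards [ho.mem_nhds hz] with x hx using hcst x hx

theorem augmentedForm_self_nonneg {k : ℕ} {U : Set Plane} (hU : Bornology.IsBounded U)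
    (l : polySpace k →ₗ[ℝ] ℝ) (f : polySpace k) : 0 ≤ augmentedForm k hU l f f :=
  add_nonneg (dirichletForm_self_nonneg U f) (mul_self_nonneg _)

/-- If the functional preserves constants, then the augmented form is nondegenerate. -/
theorem augmentedForm_injective {k : ℕ} {U : Set Plane} (ho : IsOpen U)
    (hc : IsConnected U) (hU : Bornology.IsBounded U) (l : polySpace k →ₗ[ℝ] ℝ)
    (hl : ∀ c, l ⟨fun _ => c, const_mem_polySpace k c⟩ = c) :
    Function.Injective (augmentedForm k hU l) := by
  rw [injective_iff_map_eq_zero]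
  intro f hf
  have h := LinearMap.congr_fun hf f
  rw [augmentedForm_apply, LinearMap.zero_apply] at h
  have h1 := dirichletForm_self_nonneg U f
  have h2 := mul_self_nonneg (l f)
  obtain ⟨c, hcst⟩ := eq_const_of_dirichletForm_eq_zero ho hc hU f.2 (by linarith)
  have hlf : l f = 0 := mul_self_eq_zero.1 (by linarith)
  have hfc : f = ⟨fun _ => c, const_mem_polySpace k c⟩ := Subtype.ext hcst
  rw [hfc, hl] at hlf
  rw [hfc, hlf]; rfl

/-- Riesz representation by dimension count: an injective map from a finite-dimensional space to its
dual is onto. -/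
theorem exists_augmentedForm_eq {k : ℕ} {U : Set Plane} (ho : IsOpen U)
    (hc : IsConnected U) (hU : Bornology.IsBounded U) (l : polySpace k →ₗ[ℝ] ℝ)
    (hl : ∀ c, l ⟨fun _ => c, const_mem_polySpace k c⟩ = c) (F : polySpace k →ₗ[ℝ] ℝ) :
    ∃ r, augmentedForm k hU l r = F :=
  (LinearMap.injective_iff_surjective_of_finrank_eq_finrank
    Subspace.dual_finrank_eq.symm).1 (augmentedForm_injective ho hc hU l hl) F

/-! ### Weak gradients -/

/-- The test function vanishes off U, so both integrals extend to the plane. There the identity is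
integration by parts in each direction w. -/
theorem isWeakGradient_gradient {U : Set Plane} (hU : Bornology.IsBounded U)
    {f : Plane → ℝ} (hf : ContDiff ℝ ∞ f) : IsWeakGradient U f (gradient f) := by
  refine ⟨memLp_of_continuous hf.continuous_gradient hU, fun φ hφ hc hs => ?_⟩
  have hz : ∀ x, x ∉ U → x ∉ tsupport φ := fun x hx h => hx (hs h)
  have hz' : ∀ x, x ∉ U → gradient φ x = 0 := fun x hx => by
    exact gradient_eq_zero_of_notMem_tsupport (hz x hx)
  rw [setIntegral_eq_integral_of_forall_compl_eq_zero fun x hx => by rw [hz' x hx, smul_zero],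
    setIntegral_eq_integral_of_forall_compl_eq_zero fun x hx => by
      rw [image_eq_zero_of_notMem_tsupport (hz x hx), zero_smul]]
  have hcg : HasCompactSupport (gradient φ) :=
    HasCompactSupport.intro hc fun x hx => gradient_eq_zero_of_notMem_tsupport hx
  have i1 : Integrable fun x => f x • gradient φ x :=
    (hf.continuous.smul hφ.continuous_gradient).integrable_of_hasCompactSupport
      (hcg.smul_left (f := f))
  have i2 : Integrable fun x => φ x • gradient f x :=
    (hφ.continuous.smul hf.continuous_gradient).integrable_of_hasCompactSupport
      (hc.smul_right (f' := gradient f))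
  refine ext_inner_left ℝ fun w => ?_
  rw [inner_neg_right, ← integral_inner i1, ← integral_inner i2]
  simp only [inner_smul_right, inner_gradient_right, conj_trivial]
  have j1 : Integrable (fun x => f x * fderiv ℝ φ x w) := by
    simpa only [inner_smul_right, inner_gradient_right, conj_trivial] using i1.const_inner (𝕜 := ℝ) w
  have j2 : Integrable (fun x => φ x * fderiv ℝ f x w) := by
    simpa only [inner_smul_right, inner_gradient_right, conj_trivial] using i2.const_inner (𝕜 := ℝ) w
  rw [integral_mul_fderiv_eq_neg_fderiv_mul_of_integrable (by simpa only [mul_comm] using j2) j1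
    ((hf.continuous.mul hφ.continuous).integrable_of_hasCompactSupport (hc.mul_left (f := f)))
    (fun x _ => hf.differentiable (by simp) x) (fun x _ => hφ.differentiable (by simp) x)]
  simp only [mul_comm]

theorem _root_.MeasureTheory.MemLp.integrableOn_of_isBounded {F : Type*} [NormedAddCommGroup F]
    {U : Set Plane} (hU : Bornology.IsBounded U) {f : Plane → F}
    (hf : MemLp f 2 (volume.restrict U)) : IntegrableOn f U :=
  haveI : IsFiniteMeasure (volume.restrict U) := ⟨by simpa using hU.measure_lt_top⟩
  hf.integrable one_le_two

theorem integrableOn_test_smul {F : Type*} [NormedAddCommGroup F] [NormedSpace ℝ F]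
    {U : Set Plane} {φ : Plane → ℝ} (hφ : Continuous φ) (hc : HasCompactSupport φ)
    {g : Plane → F} (hg : IntegrableOn g U) : IntegrableOn (fun x => φ x • g x) U := by
  obtain ⟨C, hC⟩ := hc.exists_bound_of_continuous hφ
  exact hg.bdd_smul C hφ.aestronglyMeasurable (.of_forall hC)

/-- The fundamental lemma of the calculus of variations. It makes `weakGrad`, which is defined by
choice, computable almost everywhere from any known weak gradient. -/
theorem IsWeakGradient.ae_eq {U : Set Plane} (ho : IsOpen U) (hU : Bornology.IsBounded U)
    {v : Plane → ℝ} {g₁ g₂ : Plane → Plane} (h₁ : IsWeakGradient U v g₁)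
    (h₂ : IsWeakGradient U v g₂) : g₁ =ᵐ[volume.restrict U] g₂ := by
  have i₁ := h₁.1.integrableOn_of_isBounded hU
  have i₂ := h₂.1.integrableOn_of_isBounded hU
  have key := ho.ae_eq_zero_of_integral_contDiff_smul_eq_zero (μ := volume) (f := g₁ - g₂)
    (i₁.sub i₂).locallyIntegrableOn (fun φ hφ hc hs => by
      have e : ∫ x, φ x • (g₁ - g₂) x = ∫ x in U, φ x • (g₁ - g₂) x :=
        (setIntegral_eq_integral_of_forall_compl_eq_zero fun x hx => by
          rw [image_eq_zero_of_notMem_tsupport fun h => hx (hs h), zero_smul]).symm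
      rw [e]
      simp only [Pi.sub_apply, smul_sub]
      rw [integral_sub (integrableOn_test_smul hφ.continuous hc i₁)
        (integrableOn_test_smul hφ.continuous hc i₂), sub_eq_zero]
      exact neg_injective ((h₁.2 φ hφ hc hs).symm.trans (h₂.2 φ hφ hc hs)))
  rw [Filter.EventuallyEq, ae_restrict_iff' ho.measurableSet]
  filter_upwards [key] with x hx hxU using sub_eq_zero.1 (hx hxU)

theorem IsWeakGradient.sub {U : Set Plane} (hU : Bornology.IsBounded U)
    {v w : Plane → ℝ} {g h : Plane → Plane} (hv : MemLp v 2 (volume.restrict U))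
    (hw : MemLp w 2 (volume.restrict U)) (hg : IsWeakGradient U v g) (hh : IsWeakGradient U w h) :
    IsWeakGradient U (v - w) (g - h) := by
  refine ⟨hg.1.sub hh.1, fun φ hφ hc hs => ?_⟩
  have hcg : HasCompactSupport (gradient φ) :=
    HasCompactSupport.intro hc fun x hx => gradient_eq_zero_of_notMem_tsupport hx
  obtain ⟨C, hC⟩ := hcg.exists_bound_of_continuous hφ.continuous_gradient
  have i : ∀ {u : Plane → ℝ}, MemLp u 2 (volume.restrict U) →
      Integrable (fun x => u x • gradient φ x) (volume.restrict U) := fun hu =>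
    (hu.integrableOn_of_isBounded hU).smul_bdd C hφ.continuous_gradient.aestronglyMeasurable
      (.of_forall hC)
  simp only [Pi.sub_apply, sub_smul, smul_sub]
  rw [integral_sub (i hv) (i hw), integral_sub
    (integrableOn_test_smul hφ.continuous hc (hg.1.integrableOn_of_isBounded hU))
    (integrableOn_test_smul hφ.continuous hc (hh.1.integrableOn_of_isBounded hU)),
    hg.2 φ hφ hc hs, hh.2 φ hφ hc hs]
  abel

theorem MemH1.isWeakGradient {U : Set Plane} {v : Plane → ℝ} (hv : MemH1 U v) :
    IsWeakGradient U v (weakGrad U v) := by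
  rw [weakGrad, dif_pos hv.2]
  exact hv.2.choose_spec

theorem IsWeakGradient.weakGrad_ae_eq {U : Set Plane} (ho : IsOpen U)
    (hU : Bornology.IsBounded U) {v : Plane → ℝ} {g : Plane → Plane} (h : IsWeakGradient U v g) :
    weakGrad U v =ᵐ[volume.restrict U] g := by
  have : IsWeakGradient U v (weakGrad U v) := by
    rw [weakGrad, dif_pos ⟨g, h⟩]
    exact Exists.choose_spec (p := IsWeakGradient U v) ⟨g, h⟩
  exact this.ae_eq ho hU h

theorem energyForm_eq_dirichletForm {U : Set Plane} (ho : IsOpen U)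
    (hU : Bornology.IsBounded U) {f g : Plane → ℝ} (hf : ContDiff ℝ ∞ f) (hg : ContDiff ℝ ∞ g) :
    energyForm U f g = dirichletForm U f g := by
  refine integral_congr_ae ?_
  filter_upwards [(isWeakGradient_gradient hU hf).weakGrad_ae_eq ho hU,
    (isWeakGradient_gradient hU hg).weakGrad_ae_eq ho hU] with x h1 h2
  rw [h1, h2]

/-- The functional `p ↦ ∫_U ∇v · ∇p` with the weak gradient of `v`. -/
noncomputable def weakEnergy (U : Set Plane) (v p : Plane → ℝ) : ℝ :=
  ∫ x in U, inner ℝ (weakGrad U v x) (gradient p x)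

theorem MemH1.integrableOn_inner {U : Set Plane} (hU : Bornology.IsBounded U)
    {v p : Plane → ℝ} (hv : MemH1 U v) (hp : ContDiff ℝ ∞ p) :
    IntegrableOn (fun x => inner ℝ (weakGrad U v x) (gradient p x)) U := by
  have h₁ := hv.isWeakGradient.1
  have h₂ := memLp_of_continuous hp.continuous_gradient hU
  exact (h₁.norm.integrable_mul h₂.norm).mono' (h₁.1.inner h₂.1)
    (.of_forall fun _ => norm_inner_le_norm _ _)

theorem MemH1.energyForm_sub {U : Set Plane} (ho : IsOpen U) (hU : Bornology.IsBounded U)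
    {v q p : Plane → ℝ} (hv : MemH1 U v) (hq : ContDiff ℝ ∞ q) (hp : ContDiff ℝ ∞ p) :
    energyForm U (v - q) p = weakEnergy U v p - dirichletForm U q p := by
  rw [weakEnergy, dirichletForm, ← integral_sub (hv.integrableOn_inner hU hp)
    (integrableOn_inner_gradient hU hq hp)]
  refine integral_congr_ae ?_
  filter_upwards [(hv.isWeakGradient.sub hU hv.1 (memLp_of_continuous hq.continuous hU)
    (isWeakGradient_gradient hU hq)).weakGrad_ae_eq ho hU,
    (isWeakGradient_gradient hU hp).weakGrad_ae_eq ho hU] with x h1 h2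
  rw [h1, h2, Pi.sub_apply, inner_sub_left]

end VEM

namespace VEM

/-! ### Geometry of the element -/

namespace PolygonalElement

variable {N : ℕ} (E : PolygonalElement N)

theorem neZero (E : PolygonalElement N) : NeZero N := ⟨by have := E.three_le; omega⟩

theorem finRotate_ne_self (E : PolygonalElement N) (i : Fin N) : finRotate N i ≠ i := by
  have h3 := E.three_le
  have := E.neZero
  rw [finRotate_apply]
  intro h
  have h1 : ((1 : Fin N) : ℕ) = 0 := by rw [left_eq_add.1 h.symm]; rfl
  rw [Fin.val_one', Nat.mod_eq_of_lt (by omega)] at h1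
  omega

theorem edgePath_zero (i : Fin N) : E.poly.edgePath ℝ i 0 = E.poly i :=
  AffineMap.lineMap_apply_zero _ _

theorem edgePath_one (i : Fin N) : E.poly.edgePath ℝ i 1 = E.poly (finRotate N i) :=
  AffineMap.lineMap_apply_one _ _

/-- A degenerate edge would make two distinct vertices coincide, against the injectivity of the
curve at parameter 0. -/
theorem edgeLength_pos (i : Fin N) : 0 < E.edgeLength i := by
  refine dist_pos.2 fun h => E.finRotate_ne_self i ?_
  exact (E.simple _ _ 0 (by simp) 0 (by simp) (by rw [edgePath_zero, edgePath_zero, h])).1.symm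

theorem edgePath_mem_closure (i : Fin N) {t : ℝ} (ht : t ∈ Set.Icc (0 : ℝ) 1) :
    E.poly.edgePath ℝ i t ∈ closure E.carrier := by
  refine frontier_subset_closure ?_
  rw [E.frontier_eq]
  exact Set.mem_iUnion.2 ⟨i, ⟨t, ht, rfl⟩⟩

theorem vertex_mem_closure (i : Fin N) : E.poly i ∈ closure E.carrier := by
  rw [← edgePath_zero]
  exact E.edgePath_mem_closure i (by simp)

theorem div_edgeLength_mem {i : Fin N} {s : ℝ} (hs : s ∈ Set.Icc 0 (E.edgeLength i)) :
    s / E.edgeLength i ∈ Set.Icc (0 : ℝ) 1 :=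
  ⟨div_nonneg hs.1 (E.edgeLength_pos i).le, (div_le_one (E.edgeLength_pos i)).2 hs.2⟩

theorem edgePoint_mem_closure {i : Fin N} {s : ℝ} (hs : s ∈ Set.Icc 0 (E.edgeLength i)) :
    E.edgePoint i s ∈ closure E.carrier :=
  E.edgePath_mem_closure i (E.div_edgeLength_mem hs)

theorem continuous_edgePoint (i : Fin N) : Continuous (E.edgePoint i) :=
  (AffineMap.continuous_of_finiteDimensional (E.poly.edgePath ℝ i)).comp
    (continuous_id.div_const _)

theorem dist_le_diameter {x y : Plane} (hx : x ∈ closure E.carrier)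
    (hy : y ∈ closure E.carrier) : dist x y ≤ E.diameter := by
  rw [diameter, ← Metric.diam_closure]
  exact Metric.dist_le_diam_of_mem E.isBounded.closure hx hy

theorem edgeLength_le_diameter (i : Fin N) : E.edgeLength i ≤ E.diameter :=
  E.dist_le_diameter (E.vertex_mem_closure _) (E.vertex_mem_closure _)

theorem minEdgeLength_le (i : Fin N) : E.minEdgeLength ≤ E.edgeLength i :=
  ciInf_le (Set.finite_range _).bddBelow i

theorem minEdgeLength_pos : 0 < E.minEdgeLength := by
  have := E.neZero
  obtain ⟨i, hi⟩ := exists_eq_ciInf_of_finite (f := E.edgeLength)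
  rw [minEdgeLength, ← hi]
  exact E.edgeLength_pos i

theorem minEdgeLength_le_diameter : E.minEdgeLength ≤ E.diameter :=
  have := E.neZero
  (E.minEdgeLength_le 0).trans (E.edgeLength_le_diameter 0)

theorem diameter_pos : 0 < E.diameter := E.minEdgeLength_pos.trans_le E.minEdgeLength_le_diameter

theorem perimeter_pos : 0 < E.perimeter :=
  have := E.neZero
  Finset.sum_pos (fun i _ => E.edgeLength_pos i) Finset.univ_nonempty

theorem volume_real_pos : 0 < volume.real E.carrier :=
  ENNReal.toReal_pos (E.isOpen.measure_pos volume E.isConnected.nonempty).ne'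
    E.isBounded.measure_lt_top.ne

end PolygonalElement

/-! ### The projections onto the constants -/

/-- `f` is integrable over the element and over each of its edges. -/
def MeanIntegrable {N : ℕ} (E : PolygonalElement N) (f : Plane → ℝ) : Prop :=
  IntegrableOn f E.carrier ∧
    ∀ i, IntervalIntegrable (fun s => f (E.edgePoint i s)) volume 0 (E.edgeLength i)

variable {N : ℕ} {E : PolygonalElement N}

theorem meanIntegrable_of_continuous {f : Plane → ℝ} (hf : Continuous f) : MeanIntegrable E f :=
  ⟨integrableOn_of_continuous hf E.isBounded,
    fun i => (hf.comp (E.continuous_edgePoint i)).intervalIntegrable _ _⟩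

theorem PolygonalElement.MemVirtualSpace.meanIntegrable {k : ℕ} {v : Plane → ℝ}
    (hv : E.MemVirtualSpace k v) : MeanIntegrable E v := by
  refine ⟨hv.memH1.1.integrableOn_of_isBounded E.isBounded, fun i => ?_⟩
  refine ContinuousOn.intervalIntegrable ?_
  rw [Set.uIcc_of_le (E.edgeLength_pos i).le]
  exact hv.continuousOn.comp (E.continuous_edgePoint i).continuousOn
    fun s hs => E.edgePoint_mem_closure hs

namespace MeanChoice

theorem apply_add (R : MeanChoice) {f g : Plane → ℝ} (hf : MeanIntegrable E f)
    (hg : MeanIntegrable E g) : R.apply E (f + g) = R.apply E f + R.apply E g := by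
  cases R
  · simp only [apply, Pi.add_apply]
    rw [integral_add hf.1 hg.1, mul_add]
  · simp only [apply, Pi.add_apply]
    rw [← mul_add, ← Finset.sum_add_distrib]
    congr 1
    exact Finset.sum_congr rfl fun i _ => intervalIntegral.integral_add (hf.2 i) (hg.2 i)
  · simp only [apply, Pi.add_apply, Finset.sum_add_distrib, mul_add]

theorem apply_smul (R : MeanChoice) (c : ℝ) (f : Plane → ℝ) :
    R.apply E (c • f) = c * R.apply E f := by
  cases R
  · simp only [apply, Pi.smul_apply, smul_eq_mul, integral_const_mul]
    ring
  · simp only [apply, Pi.smul_apply, smul_eq_mul, intervalIntegral.integral_const_mul,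
      ← Finset.mul_sum]
    ring
  · simp only [apply, Pi.smul_apply, smul_eq_mul, ← Finset.mul_sum]
    ring

theorem apply_sub (R : MeanChoice) {f g : Plane → ℝ} (hf : MeanIntegrable E f)
    (hg : MeanIntegrable E g) : R.apply E (f - g) = R.apply E f - R.apply E g := by
  have hg' : MeanIntegrable E ((-1 : ℝ) • g) :=
    ⟨hg.1.smul (-1 : ℝ), fun i => (hg.2 i).const_mul (-1)⟩
  rw [show f - g = f + (-1 : ℝ) • g by rw [neg_one_smul, sub_eq_add_neg], apply_add R hf hg',
    apply_smul]
  ring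

variable (E) in
theorem apply_const (R : MeanChoice) (c : ℝ) : R.apply E (fun _ => c) = c := by
  cases R
  · have := E.volume_real_pos.ne'
    simp only [apply, setIntegral_const, smul_eq_mul]
    field_simp
  · have := E.perimeter_pos.ne'
    simp only [apply, intervalIntegral.integral_const, sub_zero, smul_eq_mul]
    rw [← Finset.sum_mul, ← PolygonalElement.perimeter]
    field_simp
  · have := E.three_le
    have : (N : ℝ) ≠ 0 := by positivity
    simp only [apply, Finset.sum_const, Finset.card_univ, Fintype.card_fin, nsmul_eq_mul]
    field_simp

/-- Each choice is an average of values on the closure of the element. Together with `apply_const`,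
this lets later estimates treat the three choices alike. -/
theorem abs_apply_le (R : MeanChoice) {f : Plane → ℝ} {K : ℝ}
    (hf : ∀ x ∈ closure E.carrier, |f x| ≤ K) : |R.apply E f| ≤ K := by
  cases R
  · have h := norm_setIntegral_le_of_norm_le_const (μ := volume) (f := f)
      E.isBounded.measure_lt_top fun x hx => hf x (subset_closure hx)
    have hp := E.volume_real_pos
    simp only [apply]
    rw [abs_mul, abs_of_pos (inv_pos.2 hp), inv_mul_le_iff₀ hp, mul_comm]
    exact h
  · have hp := E.perimeter_pos
    simp only [apply]
    rw [abs_mul, abs_of_pos (inv_pos.2 hp), inv_mul_le_iff₀ hp, PolygonalElement.perimeter,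
      Finset.sum_mul]
    refine (Finset.abs_sum_le_sum_abs _ _).trans (Finset.sum_le_sum fun i _ => ?_)
    have h := intervalIntegral.norm_integral_le_of_norm_le_const (a := 0) (b := E.edgeLength i)
      (f := fun s => f (E.edgePoint i s)) (C := K) fun s hs => by
        rw [Set.uIoc_of_le (E.edgeLength_pos i).le] at hs
        exact hf _ (E.edgePoint_mem_closure ⟨hs.1.le, hs.2⟩)
    rwa [sub_zero, abs_of_pos (E.edgeLength_pos i), mul_comm] at h
  · have h3 := E.three_le
    have hp : (0 : ℝ) < N := by positivity
    simp only [apply]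
    rw [abs_mul, abs_of_pos (inv_pos.2 hp), inv_mul_le_iff₀ hp]
    refine (Finset.abs_sum_le_sum_abs _ _).trans
      ((Finset.sum_le_sum fun i _ => hf _ (E.vertex_mem_closure i)).trans ?_)
    simp

variable (E) in
/-- The projection onto the constants as a functional on `ℙ_k`. -/
noncomputable def polyFunctional (R : MeanChoice) (k : ℕ) : polySpace k →ₗ[ℝ] ℝ where
  toFun f := R.apply E f
  map_add' f g := R.apply_add
    (meanIntegrable_of_continuous (contDiff_of_mem_polySpace f.2).continuous)
    (meanIntegrable_of_continuous (contDiff_of_mem_polySpace g.2).continuous)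
  map_smul' c f := R.apply_smul c f

theorem polyFunctional_apply (R : MeanChoice) {k : ℕ} (f : polySpace k) :
    R.polyFunctional E k f = R.apply E f := rfl

end MeanChoice

/-! ### The projection onto polynomials -/

/-- The weak energy as a functional on `ℙ_k`. -/
noncomputable def weakEnergyFunctional (k : ℕ) {U : Set Plane} (hU : Bornology.IsBounded U)
    {v : Plane → ℝ} (hv : MemH1 U v) : polySpace k →ₗ[ℝ] ℝ where
  toFun p := weakEnergy U v p
  map_add' p q := by
    have hp := contDiff_of_mem_polySpace p.2
    have hq := contDiff_of_mem_polySpace q.2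
    rw [weakEnergy, weakEnergy, weakEnergy, ← integral_add (hv.integrableOn_inner hU hp)
      (hv.integrableOn_inner hU hq)]
    refine integral_congr_ae (.of_forall fun x => ?_)
    simp only [Submodule.coe_add,
      gradient_add' (hp.differentiable (by simp)) (hq.differentiable (by simp)), inner_add_right]
  map_smul' c p := by
    have hp := contDiff_of_mem_polySpace p.2
    rw [weakEnergy, weakEnergy, RingHom.id_apply, smul_eq_mul, ← integral_const_mul]
    refine integral_congr_ae (.of_forall fun x => ?_)
    simp only [Submodule.coe_smul, gradient_smul' (hp.differentiable (by simp)),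
      real_inner_smul_right]

theorem weakEnergyFunctional_apply {k : ℕ} {U : Set Plane} (hU : Bornology.IsBounded U)
    {v : Plane → ℝ} (hv : MemH1 U v) (p : polySpace k) :
    weakEnergyFunctional k hU hv p = weakEnergy U v p := rfl

/-- The projection is the representer, with respect to the augmented form, of a functional. -/
theorem isProjection_iff {k : ℕ} (R : MeanChoice) {v : Plane → ℝ} (hv : E.MemVirtualSpace k v)
    (q : polySpace k) : E.IsProjection R k v q ↔
      augmentedForm k E.isBounded (R.polyFunctional E k) q =
        weakEnergyFunctional k E.isBounded hv.memH1 + R.apply E v • R.polyFunctional E k := by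
  have hq := contDiff_of_mem_polySpace q.2
  have hR : R.apply E (v - q) = R.apply E v - R.apply E q :=
    R.apply_sub hv.meanIntegrable (meanIntegrable_of_continuous hq.continuous)
  constructor
  · intro h
    ext p
    have hp := contDiff_of_mem_polySpace p.2
    have h1 := h.orthogonal p (mem_polySpace.1 p.2)
    rw [hv.memH1.energyForm_sub E.isOpen E.isBounded hq hp] at h1
    have h2 := h.mean_eq
    rw [hR] at h2
    rw [augmentedForm_apply, LinearMap.add_apply, LinearMap.smul_apply, smul_eq_mul,
      weakEnergyFunctional_apply, ← sub_eq_zero.1 h1, R.polyFunctional_apply q,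
      ← sub_eq_zero.1 h2]
  · intro h
    have hmean : R.apply E q = R.apply E v := by
      -- Testing with the constant 1 kills both energies and isolates the mean condition.
      have h1 := LinearMap.congr_fun h ⟨fun _ => 1, const_mem_polySpace k 1⟩
      rw [augmentedForm_apply, LinearMap.add_apply, LinearMap.smul_apply, smul_eq_mul,
        weakEnergyFunctional_apply, R.polyFunctional_apply, R.polyFunctional_apply,
        R.apply_const] at h1
      simpa [dirichletForm, weakEnergy, gradient_fun_const] using h1
    refine ⟨mem_polySpace.1 q.2, fun p hp => ?_, by rw [hR, hmean, sub_self]⟩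
    have hp' := contDiff_of_mem_polySpace (mem_polySpace.2 hp)
    have h1 := LinearMap.congr_fun h ⟨p, mem_polySpace.2 hp⟩
    rw [augmentedForm_apply, LinearMap.add_apply, LinearMap.smul_apply, smul_eq_mul,
      weakEnergyFunctional_apply, R.polyFunctional_apply q, hmean, add_left_inj] at h1
    rw [hv.memH1.energyForm_sub E.isOpen E.isBounded hq hp', sub_eq_zero]
    exact h1.symm

theorem existsUnique_isProjection {k : ℕ} (R : MeanChoice) {v : Plane → ℝ}
    (hv : E.MemVirtualSpace k v) : ∃! q, E.IsProjection R k v q := by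
  have hl : ∀ c, R.polyFunctional E k ⟨fun _ => c, const_mem_polySpace k c⟩ = c :=
    fun c => R.apply_const E c
  obtain ⟨r, hr⟩ := exists_augmentedForm_eq E.isOpen E.isConnected E.isBounded
    (R.polyFunctional E k) hl
    (weakEnergyFunctional k E.isBounded hv.memH1 + R.apply E v • R.polyFunctional E k)
  refine ⟨r, (isProjection_iff R hv r).2 hr, fun q hq => ?_⟩
  have h := (isProjection_iff R hv ⟨q, mem_polySpace.2 hq.isPoly⟩).1 hq
  exact congrArg Subtype.val (augmentedForm_injective E.isOpen E.isConnected E.isBounded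
    (R.polyFunctional E k) hl (h.trans hr.symm))

/-! ### Oscillation of polynomials -/

/-- The oscillation of a polynomial on a large ball is bounded by its energy on the unit ball. -/
theorem exists_sq_sub_le_dirichletForm (k : ℕ) (r : ℝ) : ∃ C : ℝ, 0 ≤ C ∧
    ∀ f ∈ polySpace k, ∀ x ∈ Metric.closedBall (0 : Plane) r,
      (f x - f 0) ^ 2 ≤ C * dirichletForm (Metric.ball 0 1) f f := by
  have hU : Bornology.IsBounded (Metric.ball (0 : Plane) 1) := Metric.isBounded_ball
  have hconn : IsConnected (Metric.ball (0 : Plane) 1) :=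
    (convex_ball _ _).isConnected ⟨0, by simp⟩
  -- Evaluation at the centre fixes constants, so the form augmented by it is nondegenerate; it
  -- vanishes on f - f(0), where only the energy remains.
  let l : polySpace k →ₗ[ℝ] ℝ := (LinearMap.proj (0 : Plane)).comp (polySpace k).subtype
  let b := Module.finBasis ℝ (polySpace k)
  have hbound : ∀ i, ∃ K : ℝ, ∀ x ∈ Metric.closedBall (0 : Plane) r,
      |(b i : Plane → ℝ) x| ≤ K := fun i =>
    (isCompact_closedBall (0 : Plane) r).exists_bound_of_continuousOn
      (contDiff_of_mem_polySpace (b i).2).continuous.continuousOn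
  choose K hK using hbound
  -- Each coordinate functional of the basis is represented by some w i, so Cauchy–Schwarz for the
  -- form bounds every coordinate by the energy.
  choose w hw using fun i => exists_augmentedForm_eq Metric.isOpen_ball hconn hU l
    (fun c => rfl) (b.coord i)
  set B := augmentedForm k hU l with hB
  have hsymm : LinearMap.IsSymm B := ⟨fun f g => by
    simp only [hB, augmentedForm_apply, RingHom.id_apply, dirichletForm_comm _ (f : Plane → ℝ),
      mul_comm (l f)]⟩
  have hnn := augmentedForm_self_nonneg hU l
  have hw0 : ∀ i, 0 ≤ B (w i) (w i) * K i ^ 2 := fun i => mul_nonneg (hnn _) (sq_nonneg _)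
  refine ⟨Fintype.card (Fin (Module.finrank ℝ (polySpace k))) * ∑ i, B (w i) (w i) * K i ^ 2,
    mul_nonneg (Nat.cast_nonneg _) (Finset.sum_nonneg fun i _ => hw0 i), fun f hf x hx => ?_⟩
  let c : polySpace k := ⟨fun _ => f 0, const_mem_polySpace k _⟩
  let g : polySpace k := ⟨f, hf⟩ - c
  have hBg : B g g = dirichletForm (Metric.ball 0 1) f f := by
    have hlg : l g = 0 := sub_self (f 0)
    rw [hB, augmentedForm_apply, hlg, mul_zero, add_zero]
    refine integral_congr_ae (.of_forall fun y => ?_)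
    have : gradient (g : Plane → ℝ) y = gradient f y := by
      rw [show (g : Plane → ℝ) = f - fun _ => f 0 from rfl, gradient_sub'
        ((contDiff_of_mem_polySpace hf).differentiable (by simp)) (differentiable_const _),
        gradient_fun_const, sub_zero]
    simp only [this]
  have hgx : f x - f 0 = ∑ i, B (w i) g * (b i : Plane → ℝ) x := by
    have h := congrArg (fun q : polySpace k => (q : Plane → ℝ) x) (b.sum_repr g)
    have h' : f x - f 0 = (g : Plane → ℝ) x := rfl
    rw [h', ← h]
    simp only [Submodule.coe_sum, Finset.sum_apply, Submodule.coe_smul, Pi.smul_apply,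
      smul_eq_mul, hw, Module.Basis.coord_apply]
  rw [hgx, ← hBg, mul_assoc, Finset.sum_mul]
  refine sq_sum_le_card_mul_sum_sq.trans ?_
  rw [Finset.card_univ]
  refine mul_le_mul_of_nonneg_left (Finset.sum_le_sum fun i _ => ?_) (Nat.cast_nonneg _)
  rw [mul_pow]
  have h1 := B.apply_sq_le_of_symm hnn hsymm (w i) g
  have h2 : (b i : Plane → ℝ) x ^ 2 ≤ K i ^ 2 := sq_le_sq' (abs_le.1 (hK i x hx)).1
    (abs_le.1 (hK i x hx)).2
  calc B (w i) g ^ 2 * (b i : Plane → ℝ) x ^ 2 ≤ B (w i) (w i) * B g g * K i ^ 2 :=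
        mul_le_mul h1 h2 (sq_nonneg _) (mul_nonneg (hnn _) (hnn _))
    _ = B (w i) (w i) * K i ^ 2 * B g g := by ring

/-- The Dirichlet energy in the plane is invariant under similarities. -/
theorem dirichletForm_comp_affine {f : Plane → ℝ} (hf : ContDiff ℝ ∞ f) (a : Plane) {r : ℝ}
    (hr : 0 < r) : dirichletForm (Metric.ball 0 1) (fun y => f (a + r • y)) (fun y => f (a + r • y))
      = dirichletForm (Metric.ball a r) f f := by
  have hgrad : ∀ y, gradient (fun y => f (a + r • y)) y = r • gradient f (a + r • y) := by
    intro y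
    have h1 : HasFDerivAt (fun y : Plane => a + r • y) (r • ContinuousLinearMap.id ℝ Plane) y :=
      ((hasFDerivAt_id y).const_smul r).const_add a
    have h2 : HasFDerivAt (fun y => f (a + r • y)) _ y :=
      (hf.differentiable (by simp) (a + r • y)).hasFDerivAt.comp y h1
    rw [gradient, h2.fderiv, ContinuousLinearMap.comp_smul, ContinuousLinearMap.comp_id,
      map_smulₛₗ]
    rfl
  have hpre : Metric.ball (0 : Plane) r = (fun z => a + z) ⁻¹' Metric.ball a r := by
    ext z; simp [dist_eq_norm]
  have e1 : dirichletForm (Metric.ball a r) f f =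
      ∫ z in Metric.ball (0 : Plane) r, inner ℝ (gradient f (a + z)) (gradient f (a + z)) := by
    rw [hpre]
    exact ((measurePreserving_add_left volume a).setIntegral_preimage_emb
      (measurableEmbedding_addLeft a) (fun z => inner ℝ (gradient f z) (gradient f z)) _).symm
  -- The Jacobian r² cancels the r² produced by the two rescaled gradients; this is where dimension
  -- two matters.
  have e2 := Measure.setIntegral_comp_smul_of_pos (volume : Measure Plane)
    (fun z => inner ℝ (gradient f (a + z)) (gradient f (a + z))) (Metric.ball 0 1) hr
  rw [smul_unitBall_of_pos hr, ← e1, finrank_euclideanSpace_fin, smul_eq_mul] at e2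
  simp only [dirichletForm, hgrad, real_inner_smul_left, real_inner_smul_right]
  rw [integral_const_mul, integral_const_mul, e2, ← dirichletForm]
  field_simp

/-- On the closure, p differs from its value at the centre by at most √(C D), with D the energy.
Averaging preserves this bound, so p - R p is at most twice as large at every node. -/
theorem exists_boundaryBounded (k : ℕ) {γ : ℝ} (hγ : 0 < γ) (M : ℕ) {δ : ℝ} (hδ : 0 < δ) :
    ∃ C : ℝ, 0 < C ∧ ∀ (N : ℕ) (E : PolygonalElement N), E.IsStarShaped γ → N ≤ M →
      ∀ τ : Fin N → Fin (k - 1) → ℝ, SeparatedNodes δ τ → ∀ R : MeanChoice,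
        E.BoundaryBounded R k τ C := by
  obtain ⟨C, hC, hosc⟩ := exists_sq_sub_le_dirichletForm k γ⁻¹
  -- At most M vertices and M(k - 1) interior nodes each contribute 4CD; the 1 keeps the constant
  -- positive.
  refine ⟨(M + M * (k - 1 : ℕ)) * (4 * C) + 1, by positivity,
    fun N E hE hN τ hτ R p hp => ?_⟩
  obtain ⟨a, ρ, hρ, hball, -⟩ := hE
  have hρ0 : 0 < ρ := (mul_pos hγ E.diameter_pos).trans_le hρ
  have hpV := mem_polySpace.2 hp
  have hpc := contDiff_of_mem_polySpace hpV
  set D := energyForm E.carrier p p with hD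
  have hDd : D = dirichletForm E.carrier p p :=
    energyForm_eq_dirichletForm E.isOpen E.isBounded hpc hpc
  have hD0 : 0 ≤ D := hDd ▸ dirichletForm_self_nonneg _ _
  have haE : a ∈ E.carrier := hball (Metric.mem_ball_self hρ0)
  have hpt : ∀ x ∈ closure E.carrier, |p x - p a| ≤ √(C * D) := by
    intro x hx
    refine Real.abs_le_sqrt ?_
    -- Since |x - a| ≤ h_E ≤ ρ/γ.
    have hy : ρ⁻¹ • (x - a) ∈ Metric.closedBall (0 : Plane) γ⁻¹ := by
      rw [mem_closedBall_zero_iff, norm_smul, norm_inv, Real.norm_of_nonneg hρ0.le,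
        inv_mul_le_iff₀ hρ0, ← dist_eq_norm, ← div_eq_mul_inv, le_div_iff₀ hγ, mul_comm]
      exact (mul_le_mul_of_nonneg_left (E.dist_le_diameter hx (subset_closure haE))
        hγ.le).trans hρ
    have h := hosc _ (comp_affine_mem_polySpace hpV a ρ) _ hy
    simp only [smul_zero, add_zero, smul_inv_smul₀ hρ0.ne', add_sub_cancel] at h
    rw [dirichletForm_comp_affine hpc a hρ0] at h
    refine h.trans (mul_le_mul_of_nonneg_left ?_ hC)
    exact hDd ▸ dirichletForm_mono hball E.isBounded hpc
  have hsub : ∀ x ∈ closure E.carrier, E.subMean R p x * E.subMean R p x ≤ 4 * C * D := by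
    intro x hx
    have h1 : R.apply E (fun x => p x - p a) = R.apply E p - p a := by
      have := R.apply_sub (E := E) (meanIntegrable_of_continuous hpc.continuous)
        (meanIntegrable_of_continuous (f := fun _ => p a) continuous_const)
      rwa [R.apply_const] at this
    have h2 := R.abs_apply_le hpt
    rw [h1] at h2
    have h3 : |E.subMean R p x| ≤ 2 * √(C * D) := by
      rw [PolygonalElement.subMean, show p x - R.apply E p = (p x - p a) - (R.apply E p - p a)
        by ring]
      exact (abs_sub _ _).trans (by linarith [hpt x hx])
    have h4 : |E.subMean R p x| ^ 2 ≤ (2 * √(C * D)) ^ 2 := pow_le_pow_left₀ (abs_nonneg _) h3 2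
    rw [sq_abs, mul_pow, Real.sq_sqrt (mul_nonneg hC hD0)] at h4
    linarith
  have hτ' : ∀ i m, τ i m ∈ Set.Icc (0 : ℝ) 1 := fun i m =>
    ⟨hδ.le.trans (hτ.1 i m).1, (hτ.1 i m).2.trans (by linarith)⟩
  have hN' : (N : ℝ) ≤ M := by exact_mod_cast hN
  have hCD : 0 ≤ 4 * C * D := by positivity
  calc E.boundaryForm τ (E.subMean R p) (E.subMean R p)
      ≤ ∑ _i : Fin N, 4 * C * D + ∑ _i : Fin N, ∑ _m : Fin (k - 1), 4 * C * D :=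
        add_le_add (Finset.sum_le_sum fun i _ => hsub _ (E.vertex_mem_closure i))
          (Finset.sum_le_sum fun i _ => Finset.sum_le_sum fun m _ =>
            hsub _ (E.edgePath_mem_closure i (hτ' i m)))
    _ = N * (4 * C * D) + N * ((k - 1 : ℕ) * (4 * C * D)) := by simp
    _ ≤ M * (4 * C * D) + M * ((k - 1 : ℕ) * (4 * C * D)) := by gcongr
    _ ≤ ((M + M * (k - 1 : ℕ)) * (4 * C) + 1) * D := by nlinarith

end VEM

namespace VEM

/-! ### Polynomials in one variable with separated nodes -/

/-- Factors are exchanged one at a time, each exchange costing D^card · h. It yields the Lipschitz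
bound for the Lagrange basis. -/
theorem abs_prod_sub_prod_le {ι : Type*} (s : Finset ι) (f g : ι → ℝ) {D h : ℝ}
    (hf : ∀ i ∈ s, |f i| ≤ D) (hg : ∀ i ∈ s, |g i| ≤ D) (hfg : ∀ i ∈ s, |f i - g i| ≤ D * h)
    (hD : 0 ≤ D) (hh : 0 ≤ h) :
    |∏ i ∈ s, f i - ∏ i ∈ s, g i| ≤ s.card * D ^ s.card * h := by
  classical
  induction s using Finset.induction_on with
  | empty => simp
  | insert a s ha ih =>
    rw [Finset.prod_insert ha, Finset.prod_insert ha, Finset.card_insert_of_notMem ha]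
    have ih' := ih (fun i hi => hf i (Finset.mem_insert_of_mem hi))
      (fun i hi => hg i (Finset.mem_insert_of_mem hi))
      (fun i hi => hfg i (Finset.mem_insert_of_mem hi))
    have hp : |∏ i ∈ s, g i| ≤ D ^ s.card := by
      rw [Finset.abs_prod]
      exact (Finset.prod_le_prod (fun _ _ => abs_nonneg _)
        fun i hi => hg i (Finset.mem_insert_of_mem hi)).trans (Finset.prod_const D).le
    calc |f a * ∏ i ∈ s, f i - g a * ∏ i ∈ s, g i|
        = |f a * (∏ i ∈ s, f i - ∏ i ∈ s, g i) + (f a - g a) * ∏ i ∈ s, g i| := by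
          congr 1; ring
      _ ≤ |f a| * |∏ i ∈ s, f i - ∏ i ∈ s, g i| + |f a - g a| * |∏ i ∈ s, g i| := by
          rw [← abs_mul, ← abs_mul]; exact abs_add_le _ _
      _ ≤ D * (s.card * D ^ s.card * h) + D * h * D ^ s.card := by
          have h1 := hf a (Finset.mem_insert_self _ _)
          have h2 := hfg a (Finset.mem_insert_self _ _)
          gcongr
      _ = ((s.card + 1 : ℕ) : ℝ) * D ^ (s.card + 1) * h := by push_cast; ring

/-- Sup and Lipschitz bounds on `[0, 1]` for a polynomial in terms of its values at nodes that are
separated by at least `δ`. -/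
theorem abs_eval_le_of_separated {ι : Type*} [Fintype ι] {x : ι → ℝ} {δ : ℝ}
    (hδ : 0 < δ) (hδ1 : δ ≤ 1) (hx : ∀ i, x i ∈ Set.Icc (0 : ℝ) 1)
    (hsep : ∀ i j, i ≠ j → δ ≤ |x i - x j|) {q : Polynomial ℝ}
    (hq : q.degree < Fintype.card ι) {A : ℝ} (hA : ∀ i, |q.eval (x i)| ≤ A) :
    (∀ t ∈ Set.Icc (0 : ℝ) 1, |q.eval t| ≤
      Fintype.card ι * (Fintype.card ι * δ⁻¹ ^ Fintype.card ι) * A) ∧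
    ∀ t ∈ Set.Icc (0 : ℝ) 1, ∀ u ∈ Set.Icc (0 : ℝ) 1, |q.eval t - q.eval u| ≤
      Fintype.card ι * (Fintype.card ι * δ⁻¹ ^ Fintype.card ι) * A * |t - u| := by
  classical
  set n := Fintype.card ι with hn
  have hinj : Set.InjOn x (Finset.univ : Finset ι) := fun i _ j _ hij => by
    by_contra hne
    have := hsep i j hne
    rw [hij, sub_self, abs_zero] at this
    linarith
  have hD1 : 1 ≤ δ⁻¹ := (one_le_inv₀ hδ).2 hδ1
  have hrep : ∀ t, q.eval t = ∑ i, q.eval (x i) * ∏ j ∈ Finset.univ.erase i,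
      ((x i - x j)⁻¹ * (t - x j)) := by
    intro t
    conv_lhs => rw [Lagrange.eq_interpolate hinj hq]
    simp [Lagrange.interpolate_apply, Polynomial.eval_finsetSum, Lagrange.basis,
      Polynomial.eval_prod, Lagrange.basisDivisor]
  have hinv : ∀ i, ∀ j ∈ Finset.univ.erase i, |(x i - x j)⁻¹| ≤ δ⁻¹ := fun i j hj => by
    rw [abs_inv]
    exact inv_anti₀ hδ (hsep i j (Finset.ne_of_mem_erase hj).symm)
  have hfac : ∀ t ∈ Set.Icc (0 : ℝ) 1, ∀ i, ∀ j ∈ Finset.univ.erase i,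
      |(x i - x j)⁻¹ * (t - x j)| ≤ δ⁻¹ := fun t ht i j hj => by
    rw [abs_mul]
    have h1 : |t - x j| ≤ 1 := by
      rw [abs_le]; constructor <;> linarith [ht.1, ht.2, (hx j).1, (hx j).2]
    calc _ ≤ δ⁻¹ * 1 := mul_le_mul (hinv i j hj) h1 (abs_nonneg _) (by positivity)
      _ = δ⁻¹ := mul_one _
  have hcard : ∀ i : ι, (Finset.univ.erase i).card ≤ n := fun i => Finset.card_le_univ _
  -- The index i serves as a witness that there is a node; `ι` may be empty.
  have hnn : ∀ i : ι, (1 : ℝ) ≤ n := fun i => by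
    exact_mod_cast Fintype.card_pos_iff.2 ⟨i⟩
  have hpow : ∀ i : ι, δ⁻¹ ^ (Finset.univ.erase i).card ≤ δ⁻¹ ^ n := fun i =>
    pow_le_pow_right₀ hD1 (hcard i)
  have hA0 : ∀ i : ι, 0 ≤ A := fun i => (abs_nonneg _).trans (hA i)
  have hsum : ∀ B : ℝ, ∑ _i : ι, A * B = n * B * A := fun B => by
    rw [Finset.sum_const, Finset.card_univ, nsmul_eq_mul]; ring
  constructor
  · intro t ht
    rw [hrep t, ← hsum]
    refine (Finset.abs_sum_le_sum_abs _ _).trans (Finset.sum_le_sum fun i _ => ?_)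
    rw [abs_mul]
    refine mul_le_mul (hA i) ?_ (abs_nonneg _) (hA0 i)
    rw [Finset.abs_prod]
    refine (Finset.prod_le_prod (fun _ _ => abs_nonneg _) (hfac t ht i)).trans ?_
    rw [Finset.prod_const]
    refine (hpow i).trans ?_
    exact le_mul_of_one_le_left (by positivity) (hnn i)
  · intro t ht u hu
    rw [hrep t, hrep u, ← Finset.sum_sub_distrib, ← hsum, Finset.sum_mul]
    refine (Finset.abs_sum_le_sum_abs _ _).trans (Finset.sum_le_sum fun i _ => ?_)
    rw [← mul_sub, abs_mul, mul_assoc]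
    refine mul_le_mul (hA i) ?_ (abs_nonneg _) (hA0 i)
    refine (abs_prod_sub_prod_le _ _ _ (hfac t ht i) (hfac u hu i) (fun j hj => ?_)
      (by positivity) (abs_nonneg (t - u))).trans ?_
    · rw [← mul_sub, sub_sub_sub_cancel_right, abs_mul]
      exact mul_le_mul_of_nonneg_right (hinv i j hj) (abs_nonneg _)
    · have h1 : ((Finset.univ.erase i).card : ℝ) ≤ n := by exact_mod_cast hcard i
      have h2 := hpow i
      gcongr

/-- Sup and Lipschitz bounds for a polynomial of degree `k` in terms of its values at the endpoints
of `[0, 1]` and at `k - 1` interior nodes. -/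
theorem exists_abs_eval_le {k : ℕ} (hk : 1 ≤ k) {δ : ℝ} (hδ : 0 < δ) : ∃ C : ℝ, 0 < C ∧
    ∀ σ : Fin (k - 1) → ℝ, (∀ m, σ m ∈ Set.Icc δ (1 - δ)) → (∀ m n, m ≠ n → δ ≤ |σ m - σ n|) →
    ∀ q : Polynomial ℝ, q.natDegree ≤ k → ∀ A : ℝ, |q.eval 0| ≤ A → |q.eval 1| ≤ A →
    (∀ m, |q.eval (σ m)| ≤ A) →
    (∀ t ∈ Set.Icc (0 : ℝ) 1, |q.eval t| ≤ C * A) ∧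
    ∀ t ∈ Set.Icc (0 : ℝ) 1, ∀ u ∈ Set.Icc (0 : ℝ) 1,
      |q.eval t - q.eval u| ≤ C * A * |t - u| := by
  have hcard : Fintype.card (Fin (k - 1) ⊕ Bool) = k + 1 := by simp; omega
  -- The nodes are the interior ones plus the endpoints, indexed by `Bool`. For k = 1 only the
  -- endpoints remain, at distance 1, and δ may exceed 1; hence the minimum.
  have hδ' : 0 < min δ 1 := lt_min hδ one_pos
  refine ⟨((k + 1 : ℕ) : ℝ) * ((k + 1 : ℕ) * (min δ 1)⁻¹ ^ (k + 1)), by positivity,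
    fun σ hσ hsep q hq A h0 h1 hA => ?_⟩
  rw [← hcard]
  refine abs_eval_le_of_separated (x := Sum.elim σ fun b => if b then 1 else 0) hδ' (min_le_right _ _)
    ?_ ?_ ?_ ?_
  · rintro (m | b)
    · exact ⟨hδ.le.trans (hσ m).1, (hσ m).2.trans (by linarith)⟩
    · cases b <;> simp
  · have hend : ∀ m (b : Bool), δ ≤ |σ m - if b then 1 else 0| := fun m b => by
      have := hσ m
      cases b
      · simpa using le_abs.2 (Or.inl this.1)
      · rw [abs_sub_comm]
        exact le_abs.2 (Or.inl (by simpa using by linarith [this.2]))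
    rintro (m | b) (n | b') hne
    · exact (min_le_left _ _).trans (hsep m n fun h => hne (by rw [h]))
    · exact (min_le_left _ _).trans (hend m b')
    · rw [abs_sub_comm]
      exact (min_le_left _ _).trans (hend n b)
    · cases b <;> cases b' <;> simp at hne ⊢
  · rw [hcard]
    refine (Polynomial.degree_le_of_natDegree_le hq).trans_lt ?_
    exact_mod_cast Nat.lt_succ_self k
  · rintro (m | b)
    · exact hA m
    · cases b
      · simpa using h0
      · simpa using h1

end VEM

namespace VEM

/-! ### Functions on the boundary curve -/

namespace PolygonalElement

variable {N : ℕ} (E : PolygonalElement N)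

theorem edgePoint_zero (i : Fin N) : E.edgePoint i 0 = E.poly i := by
  rw [edgePoint, zero_div, edgePath_zero]

theorem edgePoint_edgeLength (i : Fin N) :
    E.edgePoint i (E.edgeLength i) = E.poly (finRotate N i) := by
  rw [edgePoint, div_self (E.edgeLength_pos i).ne', edgePath_one]

/-- `f` is Lipschitz with constant `L` along every edge, with respect to arc length. -/
def EdgeLipschitz (L : ℝ) (f : Plane → ℝ) : Prop :=
  ∀ i, ∀ s ∈ Set.Icc 0 (E.edgeLength i), ∀ t ∈ Set.Icc 0 (E.edgeLength i),
    |f (E.edgePoint i s) - f (E.edgePoint i t)| ≤ L * |s - t|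

/-- The abscissa of the `m`-th vertex, where `m` may be equal to the number of vertices. -/
noncomputable def vertexAbscissa [NeZero N] (m : ℕ) : ℝ :=
  ∑ j ∈ Finset.range m, E.edgeLength (Fin.ofNat N j)

theorem vertexAbscissa_succ [NeZero N] (i : Fin N) :
    E.vertexAbscissa (i + 1) = E.vertexAbscissa i + E.edgeLength i := by
  rw [vertexAbscissa, Finset.sum_range_succ, Fin.ofNat_val_eq_self, ← vertexAbscissa]

theorem vertexAbscissa_card [NeZero N] : E.vertexAbscissa N = E.perimeter := by
  rw [vertexAbscissa, Finset.sum_range, perimeter]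
  simp only [Fin.ofNat_val_eq_self]

theorem abscissa_eq [NeZero N] (i : Fin N) (s : ℝ) :
    E.abscissa i s = E.vertexAbscissa i + s := by
  rw [abscissa, vertexAbscissa, ← Nat.Iio_eq_range, ← Fin.map_valEmbedding_Iio, Finset.sum_map]
  simp only [Fin.valEmbedding_apply, Fin.ofNat_val_eq_self]

theorem vertexAbscissa_mono [NeZero N] : Monotone E.vertexAbscissa :=
  monotone_nat_of_le_succ fun m => by
    rw [vertexAbscissa, vertexAbscissa, Finset.sum_range_succ]
    linarith [E.edgeLength_pos (Fin.ofNat N m)]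

theorem finRotate_ofNat [NeZero N] (m : ℕ) :
    finRotate N (Fin.ofNat N m) = Fin.ofNat N (m + 1) := by
  rw [finRotate_apply]
  ext
  simp [Fin.val_add]

variable {E} {L : ℝ} {f : Plane → ℝ}

/-- Edge bounds are chained by the triangle inequality. Natural-number indices allow n = N, which is
vertex 0 reached after a full turn. -/
theorem EdgeLipschitz.abs_vertex_sub_le [NeZero N] (hf : E.EdgeLipschitz L f) {m n : ℕ}
    (hmn : m ≤ n) : |f (E.poly (Fin.ofNat N m)) - f (E.poly (Fin.ofNat N n))| ≤
      L * (E.vertexAbscissa n - E.vertexAbscissa m) := by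
  induction n, hmn using Nat.le_induction with
  | base => simp
  | succ n _ ih =>
    have hp := E.edgeLength_pos (Fin.ofNat N n)
    have h := hf (Fin.ofNat N n) 0 ⟨le_rfl, hp.le⟩ _ ⟨hp.le, le_rfl⟩
    rw [edgePoint_zero, edgePoint_edgeLength, finRotate_ofNat, zero_sub, abs_neg,
      abs_of_pos hp] at h
    have e : E.vertexAbscissa (n + 1) = E.vertexAbscissa n + E.edgeLength (Fin.ofNat N n) := by
      rw [vertexAbscissa, Finset.sum_range_succ, ← vertexAbscissa]
    rw [e]
    refine (abs_sub_le _ (f (E.poly (Fin.ofNat N n))) _).trans ?_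
    linarith

theorem EdgeLipschitz.abs_sub_vertex_le [NeZero N] (hf : E.EdgeLipschitz L f) (i : Fin N) {s : ℝ}
    (hs : s ∈ Set.Icc 0 (E.edgeLength i)) :
    |f (E.edgePoint i s) - f (E.poly (Fin.ofNat N i))| ≤ L * s ∧
      |f (E.edgePoint i s) - f (E.poly (Fin.ofNat N (i + 1)))| ≤ L * (E.edgeLength i - s) := by
  have hp := (E.edgeLength_pos i).le
  have h0 := hf i s hs 0 ⟨le_rfl, hp⟩
  have h1 := hf i s hs _ ⟨hp, le_rfl⟩
  rw [edgePoint_zero, sub_zero, abs_of_nonneg hs.1] at h0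
  rw [edgePoint_edgeLength, abs_sub_comm s, abs_of_nonneg (sub_nonneg.2 hs.2)] at h1
  rw [← finRotate_ofNat, Fin.ofNat_val_eq_self]
  exact ⟨h0, h1⟩

/-- The Lipschitz bound along the arc that does not contain the vertex `0`. -/
theorem EdgeLipschitz.abs_sub_le_of_lt [NeZero N] (hf : E.EdgeLipschitz L f) {i j : Fin N}
    (hij : i < j) {s t : ℝ} (hs : s ∈ Set.Icc 0 (E.edgeLength i))
    (ht : t ∈ Set.Icc 0 (E.edgeLength j)) :
    |f (E.edgePoint i s) - f (E.edgePoint j t)| ≤ L * (E.abscissa j t - E.abscissa i s) := by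
  have h1 := (hf.abs_sub_vertex_le i hs).2
  have h2 := (hf.abs_sub_vertex_le j ht).1
  have h3 := hf.abs_vertex_sub_le (show (i : ℕ) + 1 ≤ j from hij)
  rw [E.vertexAbscissa_succ] at h3
  rw [abscissa_eq, abscissa_eq]
  rw [abs_le] at *
  constructor <;> linarith [h1.1, h1.2, h2.1, h2.2, h3.1, h3.2]

/-- The Lipschitz bound along the arc through the vertex `0`. -/
theorem EdgeLipschitz.abs_sub_le_of_le [NeZero N] (hf : E.EdgeLipschitz L f) {i j : Fin N}
    {s t : ℝ} (hs : s ∈ Set.Icc 0 (E.edgeLength i)) (ht : t ∈ Set.Icc 0 (E.edgeLength j)) :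
    |f (E.edgePoint i s) - f (E.edgePoint j t)| ≤
      L * (E.perimeter - (E.abscissa j t - E.abscissa i s)) := by
  have h1 := (hf.abs_sub_vertex_le i hs).1
  have h2 := (hf.abs_sub_vertex_le j ht).2
  have h3 := hf.abs_vertex_sub_le (Nat.zero_le i)
  have h4 := hf.abs_vertex_sub_le (show (j : ℕ) + 1 ≤ N from j.2)
  have e0 : E.vertexAbscissa 0 = 0 := by simp [vertexAbscissa]
  have eN : Fin.ofNat N N = Fin.ofNat N 0 := by ext; simp
  rw [E.vertexAbscissa_succ, E.vertexAbscissa_card, eN] at h4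
  rw [e0] at h3
  rw [abscissa_eq, abscissa_eq]
  rw [abs_le] at *
  constructor <;> linarith [h1.1, h1.2, h2.1, h2.2, h3.1, h3.2, h4.1, h4.2]

variable (E) in
-- The rest of the boundary joins the endpoints of the edge, so it is no shorter than the segment.
-- The proof applies the bound along the complementary arc to the distance from vertex i.
theorem two_mul_edgeLength_le_perimeter (i : Fin N) : 2 * E.edgeLength i ≤ E.perimeter := by
  have := E.neZero
  have hp := E.edgeLength_pos i
  have hlip : E.EdgeLipschitz 1 fun x => dist x (E.poly i) := fun j s _ t _ => by
    refine (abs_dist_sub_le _ _ _).trans ?_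
    rw [edgePoint, edgePoint, Polygon.edgePath, dist_lineMap_lineMap, Real.dist_eq, ← sub_div,
      abs_div, abs_of_pos (E.edgeLength_pos j), ← edgeLength,
      div_mul_cancel₀ _ (E.edgeLength_pos j).ne', one_mul]
  have h := hlip.abs_sub_le_of_le (i := i) (j := i) (s := 0) (t := E.edgeLength i)
    ⟨le_rfl, hp.le⟩ ⟨hp.le, le_rfl⟩
  rw [edgePoint_zero, edgePoint_edgeLength, dist_self, dist_comm, ← edgeLength, zero_sub, abs_neg,
    abs_of_pos hp, abscissa_eq, abscissa_eq] at h
  linarith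

theorem abs_sub_le_arcDist (i : Fin N) {s t : ℝ} (hs : s ∈ Set.Icc 0 (E.edgeLength i))
    (ht : t ∈ Set.Icc 0 (E.edgeLength i)) :
    |s - t| ≤ E.arcDist (E.abscissa i s) (E.abscissa i t) := by
  have h := E.two_mul_edgeLength_le_perimeter i
  have h1 : |s - t| ≤ E.edgeLength i := by
    rw [abs_le]; constructor <;> linarith [hs.1, hs.2, ht.1, ht.2]
  rw [arcDist, abscissa, abscissa, add_sub_add_left_eq_sub]
  exact le_min le_rfl (by linarith)

theorem arcDist_comm (a b : ℝ) : E.arcDist a b = E.arcDist b a := by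
  rw [arcDist, arcDist, abs_sub_comm]

/-- The shorter of the two arcs gives the Lipschitz bound. It contains either the end of edge i and
the start of edge j, or the start of i and the end of j; these lengths become r in the kernel. -/
theorem EdgeLipschitz.abs_sub_le_arcDist_of_lt (hf : E.EdgeLipschitz L f)
    {i j : Fin N} (hij : i < j) {s t : ℝ} (hs : s ∈ Set.Icc 0 (E.edgeLength i))
    (ht : t ∈ Set.Icc 0 (E.edgeLength j)) :
    |f (E.edgePoint i s) - f (E.edgePoint j t)| ≤
        L * E.arcDist (E.abscissa i s) (E.abscissa j t) ∧
      (E.edgeLength i - s + t ≤ E.arcDist (E.abscissa i s) (E.abscissa j t) ∨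
        s + (E.edgeLength j - t) ≤ E.arcDist (E.abscissa i s) (E.abscissa j t)) := by
  have := E.neZero
  have h1 := hf.abs_sub_le_of_lt hij hs ht
  have h2 := hf.abs_sub_le_of_le hs ht
  have h3 : E.edgeLength i - s + t ≤ E.abscissa j t - E.abscissa i s := by
    have := E.vertexAbscissa_mono (show (i : ℕ) + 1 ≤ j from hij)
    rw [E.vertexAbscissa_succ] at this
    rw [abscissa_eq, abscissa_eq]
    linarith
  have h4 : s + (E.edgeLength j - t) ≤ E.perimeter - (E.abscissa j t - E.abscissa i s) := by
    have h5 := E.vertexAbscissa_mono (show (j : ℕ) + 1 ≤ N from j.2)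
    have h6 := E.vertexAbscissa_mono (Nat.zero_le i)
    rw [E.vertexAbscissa_succ, E.vertexAbscissa_card] at h5
    rw [show E.vertexAbscissa 0 = 0 by simp [vertexAbscissa]] at h6
    rw [abscissa_eq, abscissa_eq]
    linarith
  have habs : |E.abscissa i s - E.abscissa j t| = E.abscissa j t - E.abscissa i s := by
    rw [abs_sub_comm, abs_of_nonneg]
    linarith [hs.2, ht.1]
  rw [arcDist, habs]
  rcases min_choice (E.abscissa j t - E.abscissa i s)
    (E.perimeter - (E.abscissa j t - E.abscissa i s)) with h | h
  · rw [h]; exact ⟨h1, Or.inl h3⟩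
  · rw [h]; exact ⟨h2, Or.inr h4⟩

theorem EdgeLipschitz.abs_sub_le_arcDist_of_ne (hf : E.EdgeLipschitz L f)
    {i j : Fin N} (hij : i ≠ j) {s t : ℝ} (hs : s ∈ Set.Icc 0 (E.edgeLength i))
    (ht : t ∈ Set.Icc 0 (E.edgeLength j)) :
    |f (E.edgePoint i s) - f (E.edgePoint j t)| ≤
        L * E.arcDist (E.abscissa i s) (E.abscissa j t) ∧
      (E.edgeLength i - s + t ≤ E.arcDist (E.abscissa i s) (E.abscissa j t) ∨
        s + (E.edgeLength j - t) ≤ E.arcDist (E.abscissa i s) (E.abscissa j t)) := by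
  rcases lt_or_gt_of_ne hij with h | h
  · exact hf.abs_sub_le_arcDist_of_lt h hs ht
  · have h1 := hf.abs_sub_le_arcDist_of_lt h ht hs
    rw [arcDist_comm, abs_sub_comm]
    exact ⟨h1.1, h1.2.symm.imp (by rw [add_comm]; exact id) (by rw [add_comm]; exact id)⟩

end PolygonalElement

/-! ### Integrals of the kernel -/

theorem lintegral_Icc_of_hasDerivAt {g G : ℝ → ℝ} {b : ℝ} (hb : 0 ≤ b)
    (hg : ContinuousOn g (Set.Icc 0 b)) (hg0 : ∀ t ∈ Set.Icc 0 b, 0 ≤ g t)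
    (hG : ∀ t ∈ Set.Icc 0 b, HasDerivAt G (g t) t) :
    ∫⁻ t in Set.Icc 0 b, ENNReal.ofReal (g t) = ENNReal.ofReal (G b - G 0) := by
  rw [← ofReal_integral_eq_lintegral_ofReal (hg.integrableOn_compact isCompact_Icc)
    ((ae_restrict_iff' measurableSet_Icc).2 (.of_forall hg0)), integral_Icc_eq_integral_Ioc,
    ← intervalIntegral.integral_of_le hb]
  congr 1
  rw [← Set.uIcc_of_le hb] at hg hG
  exact intervalIntegral.integral_eq_sub_of_hasDerivAt hG hg.intervalIntegrable

theorem lintegral_Icc_sub_left (g : ℝ → ℝ≥0∞) (b : ℝ) :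
    ∫⁻ t in Set.Icc 0 b, g (b - t) = ∫⁻ t in Set.Icc 0 b, g t := by
  have h := (Measure.measurePreserving_sub_left volume b).setLIntegral_comp_preimage_emb
    (MeasurableEquiv.subLeft b).measurableEmbedding g (Set.Icc 0 b)
  rwa [Set.preimage_const_sub_Icc, sub_self, sub_zero] at h

theorem lintegral_div_sq_le {c m x b : ℝ} (hc : 0 ≤ c) (hm : 0 < m) (hx : 0 ≤ x) (hb : 0 ≤ b) :
    ∫⁻ t in Set.Icc 0 b, ENNReal.ofReal (c / (x + t + m) ^ 2) ≤ ENNReal.ofReal (c / (x + m)) := by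
  have hpos : ∀ t ∈ Set.Icc 0 b, x + t + m ≠ 0 := fun t ht => by
    have := ht.1; positivity
  rw [lintegral_Icc_of_hasDerivAt (g := fun t => c / (x + t + m) ^ 2) (G := fun t => -(c / (x + t + m))) hb
    (ContinuousOn.div (by fun_prop) (by fun_prop) fun t ht => pow_ne_zero 2 (hpos t ht))
    (fun t _ => by positivity) fun t ht => ?_]
  · refine ENNReal.ofReal_le_ofReal ?_
    have : 0 ≤ c / (x + b + m) := by positivity
    simp only [add_zero]
    linarith
  · have h := (((hasDerivAt_id t).const_add x).add_const m).fun_inv (hpos t ht)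
    refine ((h.const_mul c).fun_neg.congr_deriv ?_).congr_of_eventuallyEq (.of_forall fun u => ?_)
    · simp only [id]
      ring
    · simp only [id]
      ring

theorem lintegral_div_le {c m b : ℝ} (hc : 0 ≤ c) (hm : 0 < m) (hb : 0 ≤ b) :
    ∫⁻ s in Set.Icc 0 b, ENNReal.ofReal (c / (s + m)) ≤
      ENNReal.ofReal (c * Real.log (1 + b / m)) := by
  have hpos : ∀ s ∈ Set.Icc 0 b, s + m ≠ 0 := fun s hs => by
    have := hs.1; positivity
  rw [lintegral_Icc_of_hasDerivAt (g := fun s => c / (s + m)) (G := fun s => c * Real.log (s + m)) hb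
    (ContinuousOn.div (by fun_prop) (by fun_prop) hpos)
    (fun s hs => by have := hs.1; positivity) fun s hs => ?_]
  · rw [← mul_sub, zero_add, ← Real.log_div (by positivity) hm.ne', add_div, div_self hm.ne',
      add_comm]
  · refine ((((hasDerivAt_id s).add_const m).log (hpos s hs)).const_mul c).congr_deriv ?_
    simp only [id]
    ring

/-- The inner integration turns the inverse square into c/(x + m), uniformly in b, and the outer one
gives the logarithm. Reflecting the interval reduces both terms to the same integrals. -/
theorem lintegral_lintegral_kernel_le {c m a b : ℝ} (hc : 0 ≤ c) (hm : 0 < m) (ha : 0 ≤ a)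
    (hb : 0 ≤ b) :
    ∫⁻ s in Set.Icc 0 a, ∫⁻ t in Set.Icc 0 b,
      (ENNReal.ofReal (c / (a - s + t + m) ^ 2) + ENNReal.ofReal (c / (s + (b - t) + m) ^ 2)) ≤
      ENNReal.ofReal (2 * (c * Real.log (1 + a / m))) := by
  have hinner : ∀ s ∈ Set.Icc 0 a, ∫⁻ t in Set.Icc 0 b,
      (ENNReal.ofReal (c / (a - s + t + m) ^ 2) + ENNReal.ofReal (c / (s + (b - t) + m) ^ 2)) ≤
      ENNReal.ofReal (c / (a - s + m)) + ENNReal.ofReal (c / (s + m)) := fun s hs => by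
    rw [lintegral_add_left (by fun_prop)]
    refine add_le_add (lintegral_div_sq_le hc hm (sub_nonneg.2 hs.2) hb) ?_
    rw [lintegral_Icc_sub_left (fun t => ENNReal.ofReal (c / (s + t + m) ^ 2))]
    exact lintegral_div_sq_le hc hm hs.1 hb
  refine (setLIntegral_mono' measurableSet_Icc hinner).trans ?_
  have hlog : 0 ≤ c * Real.log (1 + a / m) :=
    mul_nonneg hc (Real.log_nonneg (by linarith [div_nonneg ha hm.le]))
  rw [lintegral_add_left (by fun_prop),
    lintegral_Icc_sub_left (fun s => ENNReal.ofReal (c / (s + m))), two_mul,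
    ENNReal.ofReal_add hlog hlog]
  exact add_le_add (lintegral_div_le hc hm ha) (lintegral_div_le hc hm ha)

/-- Adding |x| r ≤ 2K d and |x| m ≤ K d gives |x| (r + m) ≤ 3K d. For d = 0 the quotient is 0 by
convention. -/
theorem div_sq_le_kernel {x d r K m : ℝ} (hm : 0 < m) (hr : 0 ≤ r) (hrd : r ≤ d)
    (h1 : |x| ≤ 2 * K) (h2 : |x| ≤ K / m * d) : (x / d) ^ 2 ≤ 9 * K ^ 2 / (r + m) ^ 2 := by
  rcases (hr.trans hrd).eq_or_lt with rfl | hd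
  · rw [div_zero, zero_pow two_ne_zero]; positivity
  have h3 : |x| * m ≤ K * d := by
    rw [div_mul_eq_mul_div, le_div_iff₀ hm] at h2; exact h2
  have h4 : |x / d| ≤ 3 * K / (r + m) := by
    rw [abs_div, abs_of_pos hd, div_le_div_iff₀ hd (by positivity)]
    nlinarith [abs_nonneg x, mul_le_mul_of_nonneg_left hrd (abs_nonneg x),
      mul_le_mul_of_nonneg_right h1 hd.le]
  calc (x / d) ^ 2 = |x / d| ^ 2 := (sq_abs _).symm
    _ ≤ (3 * K / (r + m)) ^ 2 := pow_le_pow_left₀ (abs_nonneg _) h4 2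
    _ = 9 * K ^ 2 / (r + m) ^ 2 := by rw [div_pow]; ring

/-- The seminorm of a function that is bounded by `K` on the boundary, and Lipschitz with constant
`K / h_e` along every edge `e`. -/
theorem PolygonalElement.halfSeminormSq_le {N : ℕ} (E : PolygonalElement N) {f : Plane → ℝ} {K : ℝ}
    (hK : 0 ≤ K) (hbd : ∀ i, ∀ s ∈ Set.Icc 0 (E.edgeLength i), |f (E.edgePoint i s)| ≤ K)
    (hlip : ∀ i, ∀ s ∈ Set.Icc 0 (E.edgeLength i), ∀ t ∈ Set.Icc 0 (E.edgeLength i),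
      |f (E.edgePoint i s) - f (E.edgePoint i t)| ≤ K / E.edgeLength i * |s - t|) :
    E.halfSeminormSq f ≤ ENNReal.ofReal
      (N ^ 2 * (18 * K ^ 2 * Real.log (1 + E.diameter / E.minEdgeLength))) := by
  have hm := E.minEdgeLength_pos
  set m := E.minEdgeLength
  have hlip' : E.EdgeLipschitz (K / m) f := fun i s hs t ht =>
    (hlip i s hs t ht).trans (mul_le_mul_of_nonneg_right
      (div_le_div_of_nonneg_left hK hm (E.minEdgeLength_le i)) (abs_nonneg _))
  -- As h_E ≥ m, the logarithm is at least log 2, so it absorbs the diagonal terms, which carry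
  -- none.
  have hlog2 : 1 / 2 ≤ Real.log (1 + E.diameter / m) := by
    have h1 : (1 : ℝ) ≤ E.diameter / m := (one_le_div hm).2 E.minEdgeLength_le_diameter
    have h2 := Real.log_le_log two_pos (show (2 : ℝ) ≤ 1 + E.diameter / m by linarith)
    linarith [Real.log_two_gt_d9]
  have hterm : ∀ i j, ∫⁻ s in Set.Icc 0 (E.edgeLength i), ∫⁻ t in Set.Icc 0 (E.edgeLength j),
      ENNReal.ofReal (((f (E.edgePoint i s) - f (E.edgePoint j t)) /
        E.arcDist (E.abscissa i s) (E.abscissa j t)) ^ 2) ≤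
      ENNReal.ofReal (18 * K ^ 2 * Real.log (1 + E.diameter / m)) := by
    intro i j
    have hi := E.edgeLength_pos i
    have hj := E.edgeLength_pos j
    rcases eq_or_ne i j with rfl | hij
    -- On a single edge the slope K/h_e is used instead of K/m: its square times the area h_e² is
    -- K², however short the other edges are.
    · have hpt : ∀ s ∈ Set.Icc 0 (E.edgeLength i), ∀ t ∈ Set.Icc 0 (E.edgeLength i),
          ENNReal.ofReal (((f (E.edgePoint i s) - f (E.edgePoint i t)) /
            E.arcDist (E.abscissa i s) (E.abscissa i t)) ^ 2) ≤
          ENNReal.ofReal ((K / E.edgeLength i) ^ 2) := fun s hs t ht => by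
        refine ENNReal.ofReal_le_ofReal ?_
        rw [← sq_abs, abs_div]
        have h1 := hlip i s hs t ht
        have h2 := (abs_sub_le_arcDist i hs ht).trans (le_abs_self _)
        refine pow_le_pow_left₀ (by positivity) (div_le_of_le_mul₀ (abs_nonneg _) (by positivity)
          (h1.trans (mul_le_mul_of_nonneg_left h2 (by positivity)))) 2
      refine (setLIntegral_mono' measurableSet_Icc fun s hs =>
        setLIntegral_mono' measurableSet_Icc (hpt s hs)).trans ?_
      simp only [setLIntegral_const, Real.volume_Icc, sub_zero]
      rw [← ENNReal.ofReal_mul (by positivity), ← ENNReal.ofReal_mul (by positivity)]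
      refine ENNReal.ofReal_le_ofReal ?_
      rw [div_pow, mul_assoc, ← sq, div_mul_cancel₀ _ (by positivity)]
      nlinarith [sq_nonneg K]
    -- Which arc is shorter depends on s and t; summing both kernels avoids splitting the domain of
    -- integration.
    · have hpt : ∀ s ∈ Set.Icc 0 (E.edgeLength i), ∀ t ∈ Set.Icc 0 (E.edgeLength j),
          ENNReal.ofReal (((f (E.edgePoint i s) - f (E.edgePoint j t)) /
            E.arcDist (E.abscissa i s) (E.abscissa j t)) ^ 2) ≤
          ENNReal.ofReal (9 * K ^ 2 / (E.edgeLength i - s + t + m) ^ 2) +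
            ENNReal.ofReal (9 * K ^ 2 / (s + (E.edgeLength j - t) + m) ^ 2) := fun s hs t ht => by
        have h2K : |f (E.edgePoint i s) - f (E.edgePoint j t)| ≤ 2 * K :=
          (abs_sub _ _).trans (by linarith [hbd i s hs, hbd j t ht])
        obtain ⟨h1, h2 | h2⟩ := hlip'.abs_sub_le_arcDist_of_ne hij hs ht
        · exact le_add_right (ENNReal.ofReal_le_ofReal (div_sq_le_kernel hm
            (add_nonneg (sub_nonneg.2 hs.2) ht.1) h2 h2K h1))
        · exact le_add_left (ENNReal.ofReal_le_ofReal (div_sq_le_kernel hm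
            (add_nonneg hs.1 (sub_nonneg.2 ht.2)) h2 h2K h1))
      refine (setLIntegral_mono' measurableSet_Icc fun s hs =>
        setLIntegral_mono' measurableSet_Icc (hpt s hs)).trans
        ((lintegral_lintegral_kernel_le (by positivity) hm hi.le hj.le).trans
          (ENNReal.ofReal_le_ofReal ?_))
      have h3 : Real.log (1 + E.edgeLength i / m) ≤ Real.log (1 + E.diameter / m) := by
        have := E.edgeLength_le_diameter i
        exact Real.log_le_log (by positivity) (by gcongr)
      nlinarith [sq_nonneg K]
  calc E.halfSeminormSq f
      ≤ ∑ _i : Fin N, ∑ _j : Fin N,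
          ENNReal.ofReal (18 * K ^ 2 * Real.log (1 + E.diameter / m)) :=
        Finset.sum_le_sum fun i _ => Finset.sum_le_sum fun j _ => hterm i j
    _ = ENNReal.ofReal (N ^ 2 * (18 * K ^ 2 * Real.log (1 + E.diameter / m))) := by
        rw [ENNReal.ofReal_mul (p := (N : ℝ) ^ 2) (by positivity),
          ENNReal.ofReal_pow (by positivity), ENNReal.ofReal_natCast]
        simp only [Finset.sum_const, Finset.card_univ, Fintype.card_fin, nsmul_eq_mul]
        ring

end VEM

namespace VEM

/-! ### Coercivity of the boundary form -/

variable {N : ℕ} {E : PolygonalElement N}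

theorem PolygonalElement.halfSeminormSq_subMean (R : MeanChoice) (v : Plane → ℝ) :
    E.halfSeminormSq (E.subMean R v) = E.halfSeminormSq v := by
  simp only [halfSeminormSq, subMean, sub_sub_sub_cancel_right]

theorem PolygonalElement.boundaryForm_self_nonneg {k : ℕ} (τ : Fin N → Fin (k - 1) → ℝ)
    (w : Plane → ℝ) : 0 ≤ E.boundaryForm τ w w :=
  add_nonneg (Finset.sum_nonneg fun _ _ => mul_self_nonneg _)
    (Finset.sum_nonneg fun _ _ => Finset.sum_nonneg fun _ _ => mul_self_nonneg _)

theorem PolygonalElement.abs_vertex_le {k : ℕ} (τ : Fin N → Fin (k - 1) → ℝ)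
    (w : Plane → ℝ) (i : Fin N) : |w (E.poly i)| ≤ √(E.boundaryForm τ w w) := by
  refine Real.abs_le_sqrt ?_
  rw [sq]
  refine le_add_of_le_of_nonneg (Finset.single_le_sum (f := fun i => w (E.poly i) * w (E.poly i))
    (fun _ _ => mul_self_nonneg _) (Finset.mem_univ i))
    (Finset.sum_nonneg fun _ _ => Finset.sum_nonneg fun _ _ => mul_self_nonneg _)

theorem PolygonalElement.abs_node_le {k : ℕ} (τ : Fin N → Fin (k - 1) → ℝ)
    (w : Plane → ℝ) (i : Fin N) (m : Fin (k - 1)) :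
    |w (E.poly.edgePath ℝ i (τ i m))| ≤ √(E.boundaryForm τ w w) := by
  refine Real.abs_le_sqrt ?_
  rw [sq]
  refine le_add_of_nonneg_of_le (Finset.sum_nonneg fun _ _ => mul_self_nonneg _) ?_
  refine le_trans ?_ (Finset.single_le_sum (f := fun i => ∑ m,
    w (E.poly.edgePath ℝ i (τ i m)) * w (E.poly.edgePath ℝ i (τ i m)))
    (fun _ _ => Finset.sum_nonneg fun _ _ => mul_self_nonneg _) (Finset.mem_univ i))
  exact Finset.single_le_sum (f := fun m =>
    w (E.poly.edgePath ℝ i (τ i m)) * w (E.poly.edgePath ℝ i (τ i m)))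
    (fun _ _ => mul_self_nonneg _) (Finset.mem_univ m)

/-- Every nodal value of v - R v is at most √S, which controls it on each edge, and the seminorm
ignores the constant R v. The energy of the projection enters only as a nonnegative term. -/
theorem exists_boundaryCoercive {k : ℕ} (hk : 1 ≤ k) (M : ℕ) {δ : ℝ} (hδ : 0 < δ) :
    ∃ C : ℝ, 0 < C ∧ ∀ (N : ℕ) (E : PolygonalElement N), N ≤ M →
      ∀ τ : Fin N → Fin (k - 1) → ℝ, SeparatedNodes δ τ → ∀ R : MeanChoice,
        E.BoundaryCoercive R k τ (C * Real.log (1 + E.diameter / E.minEdgeLength)) := by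
  obtain ⟨C, hC, hCb⟩ := exists_abs_eval_le hk hδ
  -- At most M² ordered pairs of edges contribute 18 K² times the logarithm each, with K² = C² S.
  refine ⟨M ^ 2 * (18 * C ^ 2) + 1, by positivity, fun N E hN τ hτ R v hv q _ => ?_⟩
  set w := E.subMean R v with hw
  set S := E.boundaryForm τ w w with hS
  have hS0 : 0 ≤ S := E.boundaryForm_self_nonneg τ w
  have hΛ : 0 ≤ Real.log (1 + E.diameter / E.minEdgeLength) :=
    Real.log_nonneg (by linarith [div_nonneg E.diameter_pos.le E.minEdgeLength_pos.le])
  have hq : 0 ≤ energyForm E.carrier q q := integral_nonneg fun _ => real_inner_self_nonneg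
  have hedge : ∀ i, (∀ t ∈ Set.Icc (0 : ℝ) 1, |w (E.poly.edgePath ℝ i t)| ≤ C * √S) ∧
      ∀ t ∈ Set.Icc (0 : ℝ) 1, ∀ u ∈ Set.Icc (0 : ℝ) 1,
        |w (E.poly.edgePath ℝ i t) - w (E.poly.edgePath ℝ i u)| ≤ C * √S * |t - u| := by
    intro i
    obtain ⟨r, hr, hre⟩ := hv.edge_poly i
    have hwe : ∀ t ∈ Set.Icc (0 : ℝ) 1, w (E.poly.edgePath ℝ i t) =
        (r - Polynomial.C (R.apply E v)).eval t := fun t ht => by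
      rw [hw, PolygonalElement.subMean, hre t ht, Polynomial.eval_sub, Polynomial.eval_C]
    have hdeg : (r - Polynomial.C (R.apply E v)).natDegree ≤ k := by
      rwa [Polynomial.natDegree_sub_C]
    have hmem : ∀ m, τ i m ∈ Set.Icc (0 : ℝ) 1 := fun m =>
      ⟨hδ.le.trans (hτ.1 i m).1, (hτ.1 i m).2.trans (by linarith)⟩
    obtain ⟨h1, h2⟩ := hCb (τ i) (hτ.1 i) (hτ.2 i) _ hdeg (√S)
      (by rw [← hwe 0 (by simp), E.edgePath_zero]; exact E.abs_vertex_le τ w _)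
      (by rw [← hwe 1 (by simp), E.edgePath_one]; exact E.abs_vertex_le τ w _)
      (fun m => by rw [← hwe _ (hmem m)]; exact E.abs_node_le τ w i m)
    exact ⟨fun t ht => by rw [hwe t ht]; exact h1 t ht,
      fun t ht u hu => by rw [hwe t ht, hwe u hu]; exact h2 t ht u hu⟩
  rw [← E.halfSeminormSq_subMean R v]
  refine (E.halfSeminormSq_le (K := C * √S) (by positivity)
    (fun i s hs => (hedge i).1 _ (E.div_edgeLength_mem hs)) (fun i s hs t ht => ?_)).trans
    (ENNReal.ofReal_le_ofReal ?_)
  · refine ((hedge i).2 _ (E.div_edgeLength_mem hs) _ (E.div_edgeLength_mem ht)).trans_eq ?_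
    rw [← sub_div, abs_div, abs_of_pos (E.edgeLength_pos i)]
    ring
  · have hN' : (N : ℝ) ≤ M := by exact_mod_cast hN
    rw [mul_pow, Real.sq_sqrt hS0]
    calc (N : ℝ) ^ 2 * (18 * (C ^ 2 * S) * Real.log (1 + E.diameter / E.minEdgeLength))
        ≤ M ^ 2 * (18 * (C ^ 2 * S) * Real.log (1 + E.diameter / E.minEdgeLength)) := by gcongr
      _ = M ^ 2 * (18 * C ^ 2) * Real.log (1 + E.diameter / E.minEdgeLength) * S := by ring
      _ ≤ (M ^ 2 * (18 * C ^ 2) + 1) * Real.log (1 + E.diameter / E.minEdgeLength) *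
          (S + energyForm E.carrier q q) := by gcongr <;> linarith

end VEM

/-! ### Combination of the projection and the two estimates -/

theorem theorem4p1 (k : ℕ) (hk : 1 ≤ k) (γ : ℝ) (hγ : 0 < γ) (M : ℕ) (δ : ℝ) (hδ : 0 < δ) :
    ∃ c : ℝ, 0 < c ∧
      ∀ (N : ℕ) (E : VEM.PolygonalElement N), E.IsStarShaped γ → N ≤ M →
        ∀ τ : Fin N → Fin (k - 1) → ℝ, VEM.SeparatedNodes δ τ →
          ∀ R : VEM.MeanChoice,
            (∀ v, E.MemVirtualSpace k v → ∃! q, E.IsProjection R k v q) ∧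
            ∃ C₁ C₂ : ℝ, 0 < C₁ ∧ 0 < C₂ ∧
              E.BoundaryCoercive R k τ C₁ ∧ E.BoundaryBounded R k τ C₂ ∧
              C₁ ≤ c * Real.log (1 + E.diameter / E.minEdgeLength) ∧ C₂ ≤ c := by
  obtain ⟨K₁, hK₁, h₁⟩ := VEM.exists_boundaryCoercive hk M hδ
  obtain ⟨K₂, hK₂, h₂⟩ := VEM.exists_boundaryBounded k hγ M hδ
  refine ⟨K₁ + K₂, by positivity, fun N E hE hN τ hτ R =>
    ⟨fun v hv => VEM.existsUnique_isProjection R hv, _, K₂, ?_, hK₂, h₁ N E hN τ hτ R,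
      h₂ N E hE hN τ hτ R, ?_, by linarith⟩⟩
  · have := div_pos E.diameter_pos E.minEdgeLength_pos
    exact mul_pos hK₁ (Real.log_pos (by linarith))
  · have := div_pos E.diameter_pos E.minEdgeLength_pos
    exact mul_le_mul_of_nonneg_right (by linarith) (Real.log_nonneg (by linarith))
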